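/- Let $(M_p)_{p\in\mathbb N}$ be a sequence of positive numbers with $M_0=1$ such that, for some constants $c_0,H\ge 1$: (M.1) $M_p^2\le M_{p-1}M_{p+1}$ for $p\ge 1$; (M.2) $M_p\le c_0H^p\min_{0\le q\le p}M_{p-q}M_q$ for $p\ge 0$; (M.3) $\sum_{p=q+1}^{\infty}M_{p-1}/M_p\le c_0\,q\,M_q/M_{q+1}$ for $q\ge 1$. Let $\mathfrak R$ be the set of sequences $(t_j)_{j\ge 1}$ of positive numbers which increase monotonically to infinity; for $(t_j)\in\mathfrak R$ put $T_0=1$, $T_k=\prod_{j=1}^k t_j$, and for a multi-index $\alpha\in\mathbb N^d$ write $T_\alpha=T_{|\alpha|}$, $M_\alpha=M_{|\alpha|}$. Here $D^\alpha=i^{-|\alpha|}\partial^\alpha$; l.c.s. means Hausdorff locally convex space over $\mathbb C$. Let $\tilde{\mathcal D}^{\{M_p\}}_{L^\infty}(\mathbb R^d)$ be the space of all $\varphi\in\mathcal C^\infty(\mathbb R^d)$ such that $\|\varphi\|_{(t_j)}=\sup_{\alpha\in\mathbb N^d}\sup_{x\in\mathbb R^d}|D^\alpha\varphi(x)|/(T_\alpha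 M_\alpha)<\infty$ for every $(t_j)\in\mathfrak R$, with the topology given by these norms. Let $\mathcal D^{\{M_p\}}(\mathbb R^d)$ be the space of compactly supported $\varphi\in\mathcal C^\infty(\mathbb R^d)$ such that $|D^\alpha\varphi(x)|\le C h^{|\alpha|}M_\alpha$ for all $\alpha$, $x$, with some $h,C>0$, and let $\dot{\tilde{\mathcal B}}^{\{M_p\}}(\mathbb R^d)$ be its closure in (that is, its completion in the complete space) $\tilde{\mathcal D}^{\{M_p\}}_{L^\infty}(\mathbb R^d)$, with the induced topology. For a complete l.c.s. $E$, let $\dot{\tilde{\mathcal B}}^{\{M_p\}}(\mathbb R^d;E)$ be the space of all smooth functions $\varphi:\mathbb R^d\to E$ such that, for every continuous seminorm $q$ on $E$ and every $(t_j)\in\mathfrak R$, (i) $q_{(t_j)}(\varphi)=\sup_{\alpha\in\mathbb N^d}\sup_{x\in\mathbb R^d}q\bigl(D^\alpha\varphi(x)/(T_\alpha M_\alpha)\bigr)<\infty$; (ii) for every $\varepsilon>0$ there is a compact set $K\subset\mathbb R^d$ such that $q\bigl(D^\alpha\varphi(x)/(T_\alpha M_\alpha)\bigr)\le\varepsilon$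 for all $\alpha\in\mathbb N^d$ and $x\in\mathbb R^d\setminus K$; with the locally convex topology generated by the seminorms $q_{(t_j)}$. For l.c.s. $F$ and $G$, let $F'_c$ and $G'_c$ be their duals with the topology of uniform convergence on convex circled compact sets, and let $F\,\varepsilon\,G$ be the space of all bilinear functionals on $F'_c\times G'_c$ which are hypocontinuous with respect to the equicontinuous subsets of $F'$ and $G'$, with the topology of uniform convergence on products of equicontinuous subsets of $F'$ and $G'$. Then, for every complete l.c.s. $E$, the spaces $\dot{\tilde{\mathcal B}}^{\{M_p\}}(\mathbb R^d;E)$ and $\dot{\tilde{\mathcal B}}^{\{M_p\}}(\mathbb R^d)\,\varepsilon\,E$ are isomorphic as l.c.s., i.e. there is a linear homeomorphism between them. -/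

import Mathlib

open Topology Filter Set

noncomputable section

namespace Roumieu

/-! ### Weight sequences -/

/-- A sequence `(M_p)` of positive numbers with `M_0 = 1` which satisfies the conditions
`(M.1)`, `(M.2)` and `(M.3)`. -/
structure WeightSequence where
  /-- the sequence -/
  M : ℕ → ℝ
  pos : ∀ p, 0 < M p
  zero : M 0 = 1
  /-- `(M.1)`: logarithmic convexity -/
  m1 : ∀ p, 1 ≤ p → M p ^ 2 ≤ M (p - 1) * M (p + 1)
  /-- `(M.2)`: stability under ultradifferential operators, and
  `(M.3)`: strong non-quasi-analyticity, where the sum over `p ≥ q + 1` of `M_{p-1} / M_p`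
  is written with `p = q + k + 1` -/
  m23 : ∃ c₀ H : ℝ, 1 ≤ c₀ ∧ 1 ≤ H ∧
    (∀ p q, q ≤ p → M p ≤ c₀ * H ^ p * (M (p - q) * M q)) ∧
    (∀ q, 1 ≤ q → Summable (fun k => M (q + k) / M (q + k + 1)) ∧
      ∑' k, M (q + k) / M (q + k + 1) ≤ c₀ * q * (M q / M (q + 1)))

/-- The set `𝔑` of positive sequences `(t_j)`, `j ≥ 1`, which increase monotonically to
infinity; `t j` stands for `t_{j+1}`. -/
structure RSeq where
  /-- the sequence, indexed from zero -/
  t : ℕ → ℝ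
  pos : ∀ j, 0 < t j
  mono : Monotone t
  tendsto : Tendsto t atTop atTop

/-- `T_k = t_1 ⋯ t_k`, with `T_0 = 1`. -/
def RSeq.T (t : RSeq) (k : ℕ) : ℝ := ∏ j ∈ Finset.range k, t.t j

theorem RSeq.T_pos (t : RSeq) (k : ℕ) : 0 < t.T k := Finset.prod_pos fun j _ => t.pos j

instance : Nonempty RSeq :=
  ⟨{ t := fun j => (j : ℝ) + 1
     pos := fun j => by positivity
     mono := fun i j h => by
       have : (i : ℝ) ≤ j := by exact_mod_cast h
       simpa using this
     tendsto := tendsto_atTop_add_const_right _ _ tendsto_natCast_atTop_atTop }⟩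

/-- `ℝ^d` -/
abbrev Rd (d : ℕ) : Type := EuclideanSpace ℝ (Fin d)

/-- the length `|α| = α_1 + ⋯ + α_d` of a multi-index -/
def len {d : ℕ} (α : Fin d → ℕ) : ℕ := ∑ i, α i

/-- the weight `T_α M_α = T_{|α|} M_{|α|}` -/
def weight (W : WeightSequence) {d : ℕ} (t : RSeq) (α : Fin d → ℕ) : ℝ :=
  t.T (len α) * W.M (len α)

theorem weight_pos (W : WeightSequence) {d : ℕ} (t : RSeq) (α : Fin d → ℕ) :
    0 < weight W t α := mul_pos (t.T_pos _) (W.pos _)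

/-! ### Smooth functions with values in a topological vector space -/

section Smooth

set_option linter.unusedSectionVars false

variable {d : ℕ} {E : Type*} [AddCommGroup E] [Module ℂ E] [TopologicalSpace E]

/-- `y` is the partial derivative of `f` at `x` in the `i`-th variable: the difference quotients
converge to `y` in the topology of `E`. -/
def HasPartialDerivAt (i : Fin d) (f : Rd d → E) (y : E) (x : Rd d) : Prop :=
  Tendsto (fun h : ℝ => h⁻¹ • (f (x + h • EuclideanSpace.single i (1 : ℝ)) - f x))
    (𝓝[≠] 0) (𝓝 y)

/-- The partial derivative `∂_i f` (used only where it exists). -/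
def partialDeriv (i : Fin d) (f : Rd d → E) : Rd d → E := fun x =>
  limUnder (𝓝[≠] (0 : ℝ))
    (fun h : ℝ => h⁻¹ • (f (x + h • EuclideanSpace.single i (1 : ℝ)) - f x))

/-- Iterated partial derivatives `∂_{i_1} ⋯ ∂_{i_n} f`. -/
def iterPartial : List (Fin d) → (Rd d → E) → Rd d → E
  | [], f => f
  | i :: w, f => partialDeriv i (iterPartial w f)

/-- `f` is smooth: all iterated partial derivatives exist and are continuous. -/
def IsSmooth (f : Rd d → E) : Prop :=
  ∀ w : List (Fin d), Continuous (iterPartial w f) ∧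
    ∀ i x, ∃ y, HasPartialDerivAt i (iterPartial w f) y x

/-- `D^α f = (1/i)^{|α|} ∂_1^{α_1} ⋯ ∂_d^{α_d} f`. -/
def mDeriv (α : Fin d → ℕ) (f : Rd d → E) : Rd d → E := fun x =>
  (Complex.I⁻¹ ^ len α) •
    iterPartial ((List.finRange d).flatMap fun i => List.replicate (α i) i) f x

variable [T2Space E]

theorem HasPartialDerivAt.eq {i : Fin d} {f : Rd d → E} {y : E} {x : Rd d}
    (h : HasPartialDerivAt i f y x) : partialDeriv i f x = y := h.limUnder_eq

theorem hasPartialDerivAt_of_exists {i : Fin d} {f : Rd d → E} {x : Rd d}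
    (h : ∃ y, HasPartialDerivAt i f y x) : HasPartialDerivAt i f (partialDeriv i f x) x := by
  obtain ⟨y, hy⟩ := h
  rwa [hy.eq]

variable [IsTopologicalAddGroup E] [ContinuousSMul ℂ E]

theorem HasPartialDerivAt.add {i : Fin d} {f g : Rd d → E} {y z : E} {x : Rd d}
    (hf : HasPartialDerivAt i f y x) (hg : HasPartialDerivAt i g z x) :
    HasPartialDerivAt i (f + g) (y + z) x := by
  refine (Tendsto.add hf hg).congr fun h => ?_
  rw [← smul_add]
  congr 1
  simp only [Pi.add_apply]
  abel

theorem HasPartialDerivAt.smul {i : Fin d} {f : Rd d → E} {y : E} {x : Rd d} (c : ℂ)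
    (hf : HasPartialDerivAt i f y x) : HasPartialDerivAt i (c • f) (c • y) x := by
  refine (Tendsto.const_smul hf c).congr fun h => ?_
  rw [Pi.smul_apply, Pi.smul_apply, ← smul_sub, smul_comm]

theorem iterPartial_add {f g : Rd d → E} (hf : IsSmooth f) (hg : IsSmooth g)
    (w : List (Fin d)) : iterPartial w (f + g) = iterPartial w f + iterPartial w g := by
  induction w with
  | nil => rfl
  | cons i w ih =>
    funext x
    simp only [iterPartial, ih, Pi.add_apply]
    exact ((hasPartialDerivAt_of_exists ((hf w).2 i x)).add
      (hasPartialDerivAt_of_exists ((hg w).2 i x))).eq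

theorem iterPartial_smul {f : Rd d → E} (hf : IsSmooth f) (c : ℂ)
    (w : List (Fin d)) : iterPartial w (c • f) = c • iterPartial w f := by
  induction w with
  | nil => rfl
  | cons i w ih =>
    funext x
    simp only [iterPartial, ih, Pi.smul_apply]
    exact ((hasPartialDerivAt_of_exists ((hf w).2 i x)).smul c).eq

theorem IsSmooth.add {f g : Rd d → E} (hf : IsSmooth f) (hg : IsSmooth g) :
    IsSmooth (f + g) := by
  intro w
  rw [iterPartial_add hf hg]
  refine ⟨(hf w).1.add (hg w).1, fun i x => ?_⟩
  obtain ⟨y, hy⟩ := (hf w).2 i x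
  obtain ⟨z, hz⟩ := (hg w).2 i x
  exact ⟨_, hy.add hz⟩

theorem IsSmooth.smul {f : Rd d → E} (hf : IsSmooth f) (c : ℂ) : IsSmooth (c • f) := by
  intro w
  rw [iterPartial_smul hf]
  refine ⟨(hf w).1.const_smul c, fun i x => ?_⟩
  obtain ⟨y, hy⟩ := (hf w).2 i x
  exact ⟨_, hy.smul c⟩

theorem iterPartial_zero (w : List (Fin d)) : iterPartial w (0 : Rd d → E) = 0 := by
  induction w with
  | nil => rfl
  | cons i w ih =>
    funext x
    simp only [iterPartial, ih]
    exact HasPartialDerivAt.eq (by simp [HasPartialDerivAt])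

theorem isSmooth_zero : IsSmooth (0 : Rd d → E) := by
  intro w
  rw [iterPartial_zero]
  exact ⟨continuous_zero, fun i x => ⟨0, by simp [HasPartialDerivAt]⟩⟩

theorem mDeriv_add {f g : Rd d → E} (hf : IsSmooth f) (hg : IsSmooth g) (α : Fin d → ℕ)
    (x : Rd d) : mDeriv α (f + g) x = mDeriv α f x + mDeriv α g x := by
  simp [mDeriv, iterPartial_add hf hg]

theorem mDeriv_smul {f : Rd d → E} (hf : IsSmooth f) (c : ℂ) (α : Fin d → ℕ)
    (x : Rd d) : mDeriv α (c • f) x = c • mDeriv α f x := by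
  simp only [mDeriv, iterPartial_smul hf, Pi.smul_apply]
  rw [smul_comm]

theorem mDeriv_zero (α : Fin d → ℕ) (x : Rd d) : mDeriv α (0 : Rd d → E) x = 0 := by
  simp [mDeriv, iterPartial_zero]

end Smooth

/-! ### The space of smooth functions with uniform Roumieu bounds -/

/-- A continuous seminorm on `E`. -/
abbrev ContSeminorm (E : Type*) [AddCommGroup E] [Module ℂ E] [TopologicalSpace E] : Type _ :=
  {q : Seminorm ℂ E // Continuous q}

instance (E : Type*) [AddCommGroup E] [Module ℂ E] [TopologicalSpace E] :
    Nonempty (ContSeminorm E) := ⟨⟨0, continuous_const⟩⟩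

section Spaces

variable (W : WeightSequence) (d : ℕ) (E : Type*) [AddCommGroup E] [Module ℂ E]
  [TopologicalSpace E] [T2Space E] [IsTopologicalAddGroup E] [ContinuousSMul ℂ E]

/-- The vector space of all smooth `f : ℝ^d → E` such that
`q_{(t_j)}(f) = sup_{α, x} q (D^α f(x) / (T_α M_α))` is finite for every continuous seminorm `q`
on `E` and every `(t_j) ∈ 𝔑`. -/
def boundedSubmodule : Submodule ℂ (Rd d → E) where
  carrier := {f | IsSmooth f ∧ ∀ (q : ContSeminorm E) (t : RSeq),
    ∃ C : ℝ, ∀ α x, q.1 (mDeriv α f x) / weight W t α ≤ C}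
  zero_mem' := ⟨isSmooth_zero, fun q t => ⟨0, fun α x => by simp [mDeriv_zero]⟩⟩
  add_mem' := by
    rintro f g ⟨hf, hf'⟩ ⟨hg, hg'⟩
    refine ⟨hf.add hg, fun q t => ?_⟩
    obtain ⟨C, hC⟩ := hf' q t
    obtain ⟨C', hC'⟩ := hg' q t
    refine ⟨C + C', fun α x => ?_⟩
    rw [mDeriv_add hf hg]
    refine le_trans ?_ (add_le_add (hC α x) (hC' α x))
    rw [← add_div]
    exact div_le_div_of_nonneg_right (map_add_le_add _ _ _) (weight_pos W t α).le
  smul_mem' := by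
    rintro c f ⟨hf, hf'⟩
    refine ⟨hf.smul c, fun q t => ?_⟩
    obtain ⟨C, hC⟩ := hf' q t
    refine ⟨‖c‖ * C, fun α x => ?_⟩
    rw [mDeriv_smul hf, map_smul_eq_mul, mul_div_assoc]
    exact mul_le_mul_of_nonneg_left (hC α x) (norm_nonneg c)

/-- The space of `boundedSubmodule`, as a type of its own (it does not carry the topology of
pointwise convergence). For `E = ℂ` this is the space of all smooth `φ` on `ℝ^d` with
`‖φ‖_{(t_j)} < ∞` for all `(t_j) ∈ 𝔑`. -/
def DLinf : Type _ := ↥(boundedSubmodule W d E)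

instance : AddCommGroup (DLinf W d E) := inferInstanceAs (AddCommGroup ↥(boundedSubmodule W d E))

instance : Module ℂ (DLinf W d E) := inferInstanceAs (Module ℂ ↥(boundedSubmodule W d E))

variable {W d E}

/-- the underlying function -/
def DLinf.toFun (f : DLinf W d E) : Rd d → E := f.1

theorem DLinf.isSmooth (f : DLinf W d E) : IsSmooth f.toFun := f.2.1

theorem DLinf.toFun_add (f g : DLinf W d E) : (f + g).toFun = f.toFun + g.toFun := rfl

theorem DLinf.toFun_smul (c : ℂ) (f : DLinf W d E) : (c • f).toFun = c • f.toFun := rfl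

theorem DLinf.toFun_zero : (0 : DLinf W d E).toFun = 0 := rfl

theorem DLinf.bddAbove (f : DLinf W d E) (q : ContSeminorm E) (t : RSeq) :
    BddAbove (range fun p : (Fin d → ℕ) × Rd d =>
      q.1 (mDeriv p.1 f.toFun p.2) / weight W t p.1) := by
  obtain ⟨C, hC⟩ := f.2.2 q t
  exact ⟨C, by rintro _ ⟨p, rfl⟩; exact hC p.1 p.2⟩

variable (W d E)

/-- The seminorm `q_{(t_j)}(f) = sup_{α, x} q (D^α f(x)) / (T_α M_α)`. -/
def qt : SeminormFamily ℂ (DLinf W d E) (ContSeminorm E × RSeq) := fun i =>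
  Seminorm.of
    (fun f => ⨆ p : (Fin d → ℕ) × Rd d, i.1.1 (mDeriv p.1 f.toFun p.2) / weight W i.2 p.1)
    (by
      intro f g
      refine ciSup_le fun p => ?_
      refine le_trans ?_ (add_le_add (le_ciSup (f.bddAbove i.1 i.2) p)
        (le_ciSup (g.bddAbove i.1 i.2) p))
      rw [DLinf.toFun_add, mDeriv_add f.isSmooth g.isSmooth, ← add_div]
      exact div_le_div_of_nonneg_right (map_add_le_add _ _ _) (weight_pos W i.2 p.1).le)
    (by
      intro c f
      rw [Real.mul_iSup_of_nonneg (norm_nonneg c)]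
      congr 1
      funext p
      rw [DLinf.toFun_smul, mDeriv_smul f.isSmooth, map_smul_eq_mul, mul_div_assoc])

/-- The locally convex topology generated by the seminorms `q_{(t_j)}`. -/
instance : TopologicalSpace (DLinf W d E) := (qt W d E).moduleFilterBasis.topology

theorem withSeminorms_qt : WithSeminorms (qt W d E) := ⟨rfl⟩

instance : IsTopologicalAddGroup (DLinf W d E) := (withSeminorms_qt W d E).topologicalAddGroup

instance : ContinuousSMul ℂ (DLinf W d E) := (withSeminorms_qt W d E).continuousSMul

instance : LocallyConvexSpace ℝ (DLinf W d E) := (withSeminorms_qt W d E).toLocallyConvexSpace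

/-- The space `Ḃ^{M_p}(ℝ^d; E)`: smooth functions with uniform Roumieu bounds, all of whose
derivatives vanish at infinity, uniformly with respect to the seminorms `q_{(t_j)}`. It carries
the topology generated by the (restrictions of the) seminorms `q_{(t_j)}`. -/
def BdotVec : Submodule ℂ (DLinf W d E) where
  carrier := {f | ∀ ε : ℝ, 0 < ε → ∀ (q : ContSeminorm E) (t : RSeq),
    ∃ K : Set (Rd d), IsCompact K ∧
      ∀ α, ∀ x ∉ K, q.1 (mDeriv α f.toFun x) / weight W t α ≤ ε}
  zero_mem' := fun ε hε q t => ⟨∅, isCompact_empty, fun α x _ => by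
    rw [DLinf.toFun_zero, mDeriv_zero]
    simpa using hε.le⟩
  add_mem' := by
    intro f g hf hg ε hε q t
    obtain ⟨K, hK, hK'⟩ := hf (ε / 2) (half_pos hε) q t
    obtain ⟨L, hL, hL'⟩ := hg (ε / 2) (half_pos hε) q t
    refine ⟨K ∪ L, hK.union hL, fun α x hx => ?_⟩
    rw [mem_union, not_or] at hx
    rw [DLinf.toFun_add, mDeriv_add f.isSmooth g.isSmooth]
    refine le_trans ?_ ((add_le_add (hK' α x hx.1) (hL' α x hx.2)).trans (add_halves ε).le)
    rw [← add_div]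
    exact div_le_div_of_nonneg_right (map_add_le_add _ _ _) (weight_pos W t α).le
  smul_mem' := by
    intro c f hf ε hε q t
    have hc : 0 < ‖c‖ + 1 := by positivity
    obtain ⟨K, hK, hK'⟩ := hf (ε / (‖c‖ + 1)) (div_pos hε hc) q t
    refine ⟨K, hK, fun α x hx => ?_⟩
    rw [DLinf.toFun_smul, mDeriv_smul f.isSmooth, map_smul_eq_mul, mul_div_assoc]
    calc ‖c‖ * (q.1 (mDeriv α f.toFun x) / weight W t α)
        ≤ (‖c‖ + 1) * (ε / (‖c‖ + 1)) :=
          mul_le_mul (by linarith) (hK' α x hx)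
            (div_nonneg (apply_nonneg _ _) (weight_pos W t α).le) hc.le
      _ = ε := by field_simp

/-- `𝒟^{M_p}(ℝ^d)`: compactly supported smooth functions `φ` with
`|D^α φ(x)| ≤ C h^{|α|} M_α` for some `h, C > 0`. All of them satisfy the bounds that
define `DLinf W d ℂ`. -/
def testFunctions : Submodule ℂ (DLinf W d ℂ) where
  carrier := {φ | HasCompactSupport φ.toFun ∧ ∃ h C : ℝ, 0 < h ∧ 0 < C ∧
    ∀ α x, ‖mDeriv α φ.toFun x‖ ≤ C * h ^ len α * W.M (len α)}
  zero_mem' := ⟨HasCompactSupport.zero, 1, 1, one_pos, one_pos, fun α x => by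
    rw [DLinf.toFun_zero, mDeriv_zero]
    simpa using (W.pos _).le⟩
  add_mem' := by
    rintro f g ⟨hf, h, C, hh, hC, hb⟩ ⟨hg, h', C', hh', hC', hb'⟩
    refine ⟨hf.add hg, max h h', C + C', lt_max_of_lt_left hh, by positivity, fun α x => ?_⟩
    rw [DLinf.toFun_add, mDeriv_add f.isSmooth g.isSmooth]
    refine (norm_add_le _ _).trans ((add_le_add (hb α x) (hb' α x)).trans ?_)
    have hM := (W.pos (len α)).le
    have h1 : h ^ len α ≤ max h h' ^ len α := pow_le_pow_left₀ hh.le (le_max_left _ _) _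
    have h2 : h' ^ len α ≤ max h h' ^ len α := pow_le_pow_left₀ hh'.le (le_max_right _ _) _
    rw [add_mul, add_mul]
    gcongr
  smul_mem' := by
    rintro c f ⟨hf, h, C, hh, hC, hb⟩
    refine ⟨?_, h, (‖c‖ + 1) * C, hh, by positivity, fun α x => ?_⟩
    · exact hf.comp_left (g := fun z : ℂ => c • z) (smul_zero c)
    · rw [DLinf.toFun_smul, mDeriv_smul f.isSmooth, norm_smul]
      have hM := (W.pos (len α)).le
      calc ‖c‖ * ‖mDeriv α f.toFun x‖
          ≤ (‖c‖ + 1) * (C * h ^ len α * W.M (len α)) :=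
            mul_le_mul (by linarith) (hb α x) (norm_nonneg _) (by positivity)
        _ = (‖c‖ + 1) * C * h ^ len α * W.M (len α) := by ring

/-- The scalar space `Ḃ^{M_p}(ℝ^d)`: the completion of `𝒟^{M_p}(ℝ^d)` in the complete space
`DLinf W d ℂ`, that is, the closure with the induced topology. -/
def Bdot : Submodule ℂ (DLinf W d ℂ) := (testFunctions W d).topologicalClosure

end Spaces

/-! ### The `ε` tensor product -/

section Eps

variable (F G : Type*) [AddCommGroup F] [Module ℂ F] [TopologicalSpace F]
  [AddCommGroup G] [Module ℂ G] [TopologicalSpace G]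

/-- `F'_c`: the dual of `F` with the topology of uniform convergence on convex circled compact
subsets of `F`. -/
abbrev DualC : Type _ :=
  UniformConvergenceCLM (RingHom.id ℂ) ℂ
    {K : Set F | IsCompact K ∧ Convex ℝ K ∧ Balanced ℂ K}

variable {F G}

/-- Equicontinuous subsets of the dual. -/
def EquicontSet (A : Set (DualC F)) : Prop :=
  Equicontinuous fun (u : A) (x : F) => (u : DualC F) x

/-- A bilinear functional on `F'_c × G'_c` is hypocontinuous with respect to the equicontinuous
subsets of `F'` and `G'`. (It is then separately continuous, as singletons are
equicontinuous.) -/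
structure IsHypocontinuous (b : DualC F →ₗ[ℂ] DualC G →ₗ[ℂ] ℂ) : Prop where
  left : ∀ A : Set (DualC F), EquicontSet A → ∀ U ∈ 𝓝 (0 : ℂ),
    ∃ V ∈ 𝓝 (0 : DualC G), ∀ u ∈ A, ∀ v ∈ V, b u v ∈ U
  right : ∀ B : Set (DualC G), EquicontSet B → ∀ U ∈ 𝓝 (0 : ℂ),
    ∃ V ∈ 𝓝 (0 : DualC F), ∀ v ∈ B, ∀ u ∈ V, b u v ∈ U

variable (F G)

/-- The space of hypocontinuous bilinear functionals on `F'_c × G'_c`. -/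
def epsSubmodule : Submodule ℂ (DualC F →ₗ[ℂ] DualC G →ₗ[ℂ] ℂ) where
  carrier := {b | IsHypocontinuous b}
  zero_mem' := ⟨fun _ _ _ hU => ⟨univ, univ_mem, fun _ _ _ _ => mem_of_mem_nhds hU⟩,
    fun _ _ _ hU => ⟨univ, univ_mem, fun _ _ _ _ => mem_of_mem_nhds hU⟩⟩
  add_mem' := by
    intro a b ha hb
    constructor
    · intro A hA U hU
      obtain ⟨U', hU', h⟩ := exists_nhds_zero_half hU
      obtain ⟨V, hV, h1⟩ := ha.left A hA U' hU'
      obtain ⟨V', hV', h2⟩ := hb.left A hA U' hU'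
      exact ⟨V ∩ V', inter_mem hV hV', fun u hu v hv =>
        h _ (h1 u hu v hv.1) _ (h2 u hu v hv.2)⟩
    · intro A hA U hU
      obtain ⟨U', hU', h⟩ := exists_nhds_zero_half hU
      obtain ⟨V, hV, h1⟩ := ha.right A hA U' hU'
      obtain ⟨V', hV', h2⟩ := hb.right A hA U' hU'
      exact ⟨V ∩ V', inter_mem hV hV', fun u hu v hv =>
        h _ (h1 u hu v hv.1) _ (h2 u hu v hv.2)⟩
  smul_mem' := by
    intro c b hb
    have key : ∀ U ∈ 𝓝 (0 : ℂ), (fun z : ℂ => c • z) ⁻¹' U ∈ 𝓝 (0 : ℂ) := fun U hU =>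
      (continuous_const_smul c).continuousAt.preimage_mem_nhds (by simpa using hU)
    constructor
    · intro A hA U hU
      exact hb.left A hA _ (key U hU)
    · intro A hA U hU
      exact hb.right A hA _ (key U hU)

/-- The `ε` tensor product `F ε G`. -/
def Eps : Type _ := ↥(epsSubmodule F G)

instance : AddCommGroup (Eps F G) := inferInstanceAs (AddCommGroup ↥(epsSubmodule F G))

instance : Module ℂ (Eps F G) := inferInstanceAs (Module ℂ ↥(epsSubmodule F G))

/-- The topology of uniform convergence on the products `A × B` of equicontinuous sets
`A ⊆ F'` and `B ⊆ G'`. -/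
instance : TopologicalSpace (Eps F G) :=
  TopologicalSpace.induced
    (fun b : Eps F G =>
      UniformOnFun.ofFun
        {S : Set (DualC F × DualC G) | ∃ A B, EquicontSet A ∧ EquicontSet B ∧ S = A ×ˢ B}
        (fun p => b.1 p.1 p.2))
    inferInstance

end Eps

end Roumieu

end

/-!
The isomorphism sends `φ : ℝ^d → E` to the bilinear functional `(u, e) ↦ u (e ∘ φ)`.

For this to make sense, `e ∘ φ` has to belong to the scalar space `Bdot`, which is defined as the
closure of the test functions. It is the space of all functions whose derivatives vanish at
infinity, uniformly with respect to the seminorms `‖·‖_{(t_j)}`: by `exists_geometric_bound`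
(Komatsu), every element `f` of the ambient space satisfies a bound `C h^|α| M_α`, so that the
products of `f` with dilations of a compactly supported function of class `{M_p}`, which exists
because `∑ M_p / M_{p+1}` converges (`WeightSequence.exists_cutoff`), are test functions, and they
converge to `f` if `f` vanishes at infinity (`mem_Bdot_of_mem_BdotVec`).

The functional is hypocontinuous because two sets are compact. The weighted derivatives
`D^α φ(x) / (T_α M_α)` form a precompact subset of `E` (`hasFiniteNets_derivSet`), which lies in a
convex circled compact set as `E` is complete. The functions `e ∘ φ`, where `e` runs through the
polar of a neighbourhood of zero, form a convex circled compact subset of `Bdot`, the continuous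
image of a weak-* compact set (`isCompact_compBdot_image`).

Conversely, let `b` be hypocontinuous. By Mackey–Arens (`DualC.exists_eval_eq`), the functional
`b(u, ·)` is the evaluation at a point `Φ u` of `E`, and `b(·, e)` is the evaluation at a function
`f e` in `Bdot`. The function `φ(x) = Φ(δ_x)` satisfies `e ∘ φ = f e`. A continuous seminorm `q` on
`E` is a supremum of functionals, and `f e` is bounded uniformly for `|e| ≤ q`; hence the scalar
estimates for `f e` yield smoothness of `φ` (`isSmooth_of_scalar_family`) and its bounds, while the
decay at infinity comes from the uniform decay on compact subsets of `Bdot`. The same duality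
between `q_{(t_j)}` and products of polars identifies the two topologies.
-/

noncomputable section

namespace Roumieu

/-! ### Seminorms and functionals on locally convex spaces -/

section Seminorms

set_option linter.unusedSectionVars false

variable {G : Type*} [AddCommGroup G] [Module ℂ G] [TopologicalSpace G]
  [IsTopologicalAddGroup G] [ContinuousSMul ℂ G]

open ComplexOrder in
theorem polynormableSpace_of_real [LocallyConvexSpace ℝ G] : PolynormableSpace ℂ G := by
  have : LocallyConvexSpace ℂ G := by
    refine (locallyConvexSpace_iff_exists_convex_subset_zero ℂ G).2 fun U hU => ?_
    obtain ⟨S, hS, hc, hSU⟩ :=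
      (locallyConvexSpace_iff_exists_convex_subset_zero ℝ G).1 inferInstance U hU
    exact ⟨S, hS, convex_RCLike_iff_convex_real.2 hc, hSU⟩
  have : ContinuousSMul ℝ G := IsScalarTower.continuousSMul ℂ
  exact LocallyConvexSpace.toPolynormableSpace

theorem exists_seminorm_ball_subset [LocallyConvexSpace ℝ G] {U : Set G} (hU : U ∈ 𝓝 (0 : G)) :
    ∃ q : ContSeminorm G, ∀ x, q.1 x < 1 → x ∈ U := by
  have := polynormableSpace_of_real (G := G)
  obtain ⟨s, r, hr, h⟩ := ((PolynormableSpace.withSeminorms ℂ G).mem_nhds_iff _ _).1 hU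
  have hc : Continuous (s.sup fun p : ContSeminorm G => p.1 : Seminorm ℂ G) :=
    Seminorm.continuous_finsetSup fun p _ => p.2
  refine ⟨⟨(Real.toNNReal r⁻¹) • s.sup fun p : ContSeminorm G => p.1,
    continuous_const.smul hc⟩, fun x hx => h ?_⟩
  rw [Seminorm.mem_ball, sub_zero]
  have hx' : r⁻¹ * (s.sup fun p : ContSeminorm G => p.1) x < 1 := by
    have : (Real.toNNReal r⁻¹) • (s.sup fun p : ContSeminorm G => p.1) x < 1 := hx
    rwa [NNReal.smul_def, Real.coe_toNNReal _ (by positivity)] at this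
  rwa [inv_mul_lt_iff₀ hr, mul_one] at hx'

/-- Hahn–Banach: a continuous seminorm is the maximum of the functionals which it dominates. -/
theorem exists_dual_eq_seminorm [LocallyConvexSpace ℝ G] (q : ContSeminorm G) (x : G) :
    ∃ f : G →L[ℂ] ℂ, (∀ y, ‖f y‖ ≤ q.1 y) ∧ f x = q.1 x := by
  have := polynormableSpace_of_real (G := G)
  rcases eq_or_ne x 0 with rfl | hx
  · exact ⟨0, fun y => by simp, by simp⟩
  obtain ⟨g, hg, hle⟩ := Module.Dual.exists_continuous_extension_of_le_seminorm (ℂ ∙ x)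
    (LinearPMap.mkSpanSingleton (K := ℂ) x ((q.1 x : ℝ) : ℂ) hx).toFun q.2 (by
      rintro ⟨y, hy⟩
      obtain ⟨c, rfl⟩ := Submodule.mem_span_singleton.1 hy
      have := LinearPMap.mkSpanSingleton'_apply (σ := RingHom.id ℂ) x ((q.1 x : ℝ) : ℂ) (by
        intro c hc
        simp [(smul_eq_zero.1 hc).resolve_right hx]) c hy
      refine (congrArg norm this).le.trans ?_
      simp [map_smul_eq_mul, abs_of_nonneg (apply_nonneg q.1 x)])
  refine ⟨g, hle, ?_⟩
  exact (hg ⟨x, Submodule.mem_span_singleton_self x⟩).trans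
    (LinearPMap.mkSpanSingleton_apply ℂ ℂ hx _)

theorem seminorm_le_of_dual [LocallyConvexSpace ℝ G] (q : ContSeminorm G) (x : G) {C : ℝ}
    (h : ∀ f : DualC G, (∀ y, ‖f y‖ ≤ q.1 y) → ‖f x‖ ≤ C) : q.1 x ≤ C := by
  obtain ⟨f, hf, hx⟩ := exists_dual_eq_seminorm q x
  have : ‖f x‖ ≤ C := h f hf
  rwa [hx, Complex.norm_real, Real.norm_of_nonneg (apply_nonneg _ _)] at this

theorem eq_of_dual_eq [LocallyConvexSpace ℝ G] [T2Space G] {x y : G}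
    (h : ∀ f : DualC G, f x = f y) : x = y := by
  have := polynormableSpace_of_real (G := G)
  by_contra hxy
  obtain ⟨q, hq⟩ := (PolynormableSpace.withSeminorms ℂ G).separating_of_T1 (x - y)
    (sub_ne_zero.2 hxy)
  refine hq (le_antisymm (seminorm_le_of_dual q (x - y) fun f _ => ?_) (apply_nonneg _ _))
  rw [map_sub, h f, sub_self, norm_zero]

end Seminorms

section Dual

set_option linter.unusedSectionVars false

variable {G : Type*} [AddCommGroup G] [Module ℂ G] [TopologicalSpace G]
  [IsTopologicalAddGroup G] [ContinuousSMul ℂ G]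

theorem EquicontSet.exists_seminorm [LocallyConvexSpace ℝ G] {A : Set (DualC G)}
    (hA : EquicontSet A) : ∃ q : ContSeminorm G, ∀ u ∈ A, ∀ x, ‖u x‖ ≤ q.1 x := by
  have h0 := Metric.equicontinuousAt_iff_right.1 (hA 0) 1 one_pos
  obtain ⟨q, hq⟩ := exists_seminorm_ball_subset h0
  refine ⟨q, fun u hu x => ?_⟩
  refine le_of_forall_pos_lt_add fun ε hε => ?_
  have hpos : 0 < q.1 x + ε := add_pos_of_nonneg_of_pos (apply_nonneg _ _) hε
  have hx : q.1 (((q.1 x + ε)⁻¹ : ℝ) • x) < 1 := by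
    rw [← Complex.coe_smul, map_smul_eq_mul, Complex.norm_real,
      Real.norm_of_nonneg (by positivity), inv_mul_lt_iff₀ hpos]
    linarith
  have := hq _ hx ⟨u, hu⟩
  simp only [map_zero, dist_zero_left] at this
  rw [← Complex.coe_smul, map_smul, norm_smul, Complex.norm_real,
      Real.norm_of_nonneg (by positivity), inv_mul_lt_iff₀ hpos] at this
  linarith

theorem equicontSet_of_seminorm {A : Set (DualC G)} (q : ContSeminorm G)
    (h : ∀ u ∈ A, ∀ x, ‖u x‖ ≤ q.1 x) : EquicontSet A := by
  intro x
  refine Metric.equicontinuousAt_of_continuity_modulus (fun y => q.1 (x - y)) ?_ _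
    (Eventually.of_forall fun y u => ?_)
  · have : Continuous fun y => q.1 (x - y) := q.2.comp (continuous_const.sub continuous_id)
    simpa using this.tendsto x
  · rw [dist_eq_norm, ← map_sub]
    exact h u u.2 _

theorem DualC.setOf_le_mem_nhds {K : Set G} (hK : IsCompact K ∧ Convex ℝ K ∧ Balanced ℂ K)
    {ε : ℝ} (hε : 0 < ε) : {u : DualC G | ∀ x ∈ K, ‖u x‖ ≤ ε} ∈ 𝓝 (0 : DualC G) := by
  have := UniformConvergenceCLM.eventually_nhds_zero_mapsTo (RingHom.id ℂ) (F := ℂ)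
    (𝔖 := {K : Set G | IsCompact K ∧ Convex ℝ K ∧ Balanced ℂ K}) hK
    (Metric.closedBall_mem_nhds (0 : ℂ) hε)
  filter_upwards [this] with u hu x hx
  simpa using hu hx

theorem DualC.exists_compact_of_mem_nhds {V : Set (DualC G)} (hV : V ∈ 𝓝 (0 : DualC G)) :
    ∃ K : Set G, (IsCompact K ∧ Convex ℝ K ∧ Balanced ℂ K) ∧ K.Nonempty ∧ ∃ ε : ℝ, 0 < ε ∧
      ∀ u : DualC G, (∀ x ∈ K, ‖u x‖ ≤ ε) → u ∈ V := by
  have h0 : ({0} : Set G) ∈ {K : Set G | IsCompact K ∧ Convex ℝ K ∧ Balanced ℂ K} :=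
    ⟨isCompact_singleton, convex_singleton 0, balanced_zero⟩
  have hdir : DirectedOn (· ⊆ ·) {K : Set G | IsCompact K ∧ Convex ℝ K ∧ Balanced ℂ K} := by
    intro K hK L hL
    rcases K.eq_empty_or_nonempty with rfl | hKn
    · exact ⟨L, hL, empty_subset _, subset_rfl⟩
    rcases L.eq_empty_or_nonempty with rfl | hLn
    · exact ⟨K, hK, subset_rfl, empty_subset _⟩
    open Pointwise in
    refine ⟨K + L, ⟨hK.1.add hL.1, hK.2.1.add hL.2.1, hK.2.2.add hL.2.2⟩, ?_, ?_⟩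
    · intro x hx
      exact ⟨x, hx, 0, hL.2.2.zero_mem hLn, add_zero x⟩
    · intro x hx
      exact ⟨0, hK.2.2.zero_mem hKn, x, hx, zero_add x⟩
  obtain ⟨⟨K, ε⟩, ⟨hK, hε⟩, h⟩ := (UniformConvergenceCLM.hasBasis_nhds_zero_of_basis
    (RingHom.id ℂ) ℂ _ ⟨_, h0⟩ hdir Metric.nhds_basis_closedBall).mem_iff.1 hV
  rcases K.eq_empty_or_nonempty with rfl | hKn
  · exact ⟨{0}, h0, singleton_nonempty 0, 1, one_pos, fun u _ => h fun x hx => hx.elim⟩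
  · exact ⟨K, hK, hKn, ε, hε, fun u hu => h fun x hx => by simpa using hu x hx⟩

/-- Evaluation at `x`, as a linear functional on the dual. -/
def DualC.eval (x : G) : DualC G →ₗ[ℂ] ℂ where
  toFun u := u x
  map_add' _ _ := rfl
  map_smul' _ _ := rfl

/-- Mackey–Arens: a linear functional on the dual which is bounded on a neighbourhood of zero
for uniform convergence on convex circled compact sets is the evaluation at a point. Such a
functional is dominated by the supremum over a convex circled compact set `L`; by separation in
finite dimensions, every finite family of functionals admits a suitable point of `L`, and
compactness of `L` yields a common one. -/
theorem DualC.exists_eval_eq (ℓ : DualC G →ₗ[ℂ] ℂ) {V : Set (DualC G)}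
    (hV : V ∈ 𝓝 (0 : DualC G)) (hℓ : ∀ u ∈ V, ‖ℓ u‖ ≤ 1) : ∃ x : G, ∀ u, ℓ u = u x := by
  obtain ⟨K, ⟨hK, hKc, hKb⟩, hKn, ε, hε, h⟩ := DualC.exists_compact_of_mem_nhds hV
  have key : ∀ s : Finset (DualC G), ∃ x ∈ K, ∀ u ∈ s, ℓ u = ε⁻¹ * u x := by
    classical
    intro s
    by_contra! hcon
    let Λ : G →L[ℂ] (s → ℂ) := ((ε : ℂ)⁻¹) • ContinuousLinearMap.pi fun u : s => (u.1 : G →L[ℂ] ℂ)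
    have hΛ : ∀ x u, Λ x u = (ε : ℂ)⁻¹ * u.1 x := fun x u => rfl
    have hA : IsClosed (Λ '' K) := (hK.image Λ.continuous).isClosed
    have hAc : Convex ℝ (Λ '' K) := hKc.linear_image (Λ.toLinearMap.restrictScalars ℝ)
    obtain ⟨f, r, hf, hr⟩ := RCLike.geometric_hahn_banach_closed_point (𝕜 := ℂ) hAc hA
      (x := fun u : s => ℓ u) (by
        rintro ⟨x, hx, hx'⟩
        obtain ⟨u, hu, hne⟩ := hcon x hx
        exact hne ((congrFun hx' ⟨u, hu⟩).symm.trans (by simp [hΛ])))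
    let w : DualC G := ∑ u : s, f (Pi.single u 1) • u.1
    have hfe : ∀ y : s → ℂ, f y = ∑ u, f (Pi.single u 1) * y u := by
      intro y
      conv_lhs => rw [← Finset.univ_sum_single y]
      rw [map_sum]
      refine Finset.sum_congr rfl fun u _ => ?_
      rw [mul_comm, ← smul_eq_mul (y u), ← map_smul]
      congr 1
      ext v
      by_cases huv : v = u
      · subst huv; simp
      · simp [huv]
    have hw : ∀ x, w x = ε * f (Λ x) := by
      intro x
      have : w x = ∑ u : s, f (Pi.single u 1) * u.1 x := by
        change DualC.eval x w = _
        rw [map_sum]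
        rfl
      rw [this, hfe, Finset.mul_sum]
      refine Finset.sum_congr rfl fun u _ => ?_
      rw [hΛ]
      have : (ε : ℂ) ≠ 0 := by exact_mod_cast hε.ne'
      field_simp
    have hw' : ℓ w = f fun u : s => ℓ u := by
      rw [hfe, map_sum]
      simp
    have hr0 : 0 < r := by
      have := hf _ ⟨0, hKb.zero_mem hKn, rfl⟩
      simpa using this
    -- the set `K` is circled, so the bound on the real part is a bound on the absolute value
    have hwK : ∀ x ∈ K, ‖f (Λ x)‖ ≤ r := by
      intro x hx
      obtain ⟨c, hc, hcx⟩ : ∃ c : ℂ, ‖c‖ = 1 ∧ c * f (Λ x) = ‖f (Λ x)‖ := by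
        rcases eq_or_ne (f (Λ x)) 0 with h0 | h0
        · exact ⟨1, by simp, by simp [h0]⟩
        · refine ⟨‖f (Λ x)‖ / f (Λ x), by simp [h0], by field_simp⟩
      have := hf _ ⟨c • x, hKb.smul_mem hc.le hx, rfl⟩
      rw [map_smul, map_smul, smul_eq_mul, hcx] at this
      simpa using this.le
    have h1 := hℓ ((r⁻¹ : ℂ) • w) (h _ fun x hx => by
      have : ((r⁻¹ : ℂ) • w) x = (r⁻¹ : ℂ) * w x := rfl
      rw [this, hw, norm_mul, norm_mul, norm_inv, Complex.norm_real, Complex.norm_real,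
        Real.norm_of_nonneg hr0.le, Real.norm_of_nonneg hε.le, inv_mul_le_iff₀ hr0, mul_comm r]
      exact mul_le_mul_of_nonneg_left (hwK x hx) hε.le)
    rw [map_smul, norm_smul, norm_inv, Complex.norm_real, Real.norm_of_nonneg hr0.le,
      inv_mul_le_iff₀ hr0, mul_one, hw'] at h1
    exact absurd (hr.trans_le ((Complex.re_le_norm _).trans h1)) (lt_irrefl r)
  have hcl : ∀ u : DualC G, IsClosed {x : G | ℓ u = ε⁻¹ * u x} := fun u =>
    isClosed_eq continuous_const (continuous_const.mul (u : G →L[ℂ] ℂ).continuous)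
  obtain ⟨x, -, hx⟩ := hK.inter_iInter_nonempty _ hcl fun s => by
    obtain ⟨x, hx, hxs⟩ := key s
    exact ⟨x, hx, mem_iInter₂.2 fun u hu => hxs u hu⟩
  refine ⟨((ε⁻¹ : ℝ) : ℂ) • x, fun u => ?_⟩
  rw [map_smul]
  simpa using mem_iInter.1 hx u

end Dual

/-- Total boundedness in terms of seminorms, which avoids a uniform structure on `G`. -/
def HasFiniteNets {G : Type*} [AddCommGroup G] [Module ℂ G] [TopologicalSpace G]
    (S : Set G) : Prop :=
  ∀ (q : ContSeminorm G) (ε : ℝ), 0 < ε →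
    ∃ t : Set G, t.Finite ∧ ∀ x ∈ S, ∃ y ∈ t, q.1 (x - y) ≤ ε

theorem balanced_convexHull {G : Type*} [AddCommGroup G] [Module ℂ G] {s : Set G}
    (hs : Balanced ℂ s) : Balanced ℂ (convexHull ℝ s) := by
  suffices Convex ℝ {x | ∀ a : ℂ, ‖a‖ ≤ 1 → a • x ∈ convexHull ℝ s} by
    rw [balanced_iff_smul_mem] at hs ⊢
    refine fun a ha x hx => convexHull_min ?_ this hx a ha
    exact fun y hy a ha => subset_convexHull ℝ s (hs ha hy)
  intro x hx y hy u v hu hv huv a ha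
  rw [smul_add, smul_comm a u, smul_comm a v]
  exact convex_convexHull ℝ s (hx a ha) (hy a ha) hu hv huv

/-- In a complete space, a precompact set lies in a convex circled compact set. -/
theorem HasFiniteNets.exists_compact {E : Type*} [AddCommGroup E]
    [Module ℂ E] [UniformSpace E] [IsUniformAddGroup E] [ContinuousSMul ℂ E]
    [LocallyConvexSpace ℝ E] [CompleteSpace E] {S : Set E} (hS : HasFiniteNets S) :
    ∃ K : Set E, (IsCompact K ∧ Convex ℝ K ∧ Balanced ℂ K) ∧ S ⊆ K := by
  have : ContinuousSMul ℝ E := IsScalarTower.continuousSMul ℂ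
  have h1 : TotallyBounded S := by
    rw [totallyBounded_iff_subset_finite_iUnion_nhds_zero]
    intro U hU
    obtain ⟨q, hq⟩ := exists_seminorm_ball_subset hU
    obtain ⟨t, ht, hSt⟩ := hS q (1 / 2) (by norm_num)
    refine ⟨t, ht, fun x hx => ?_⟩
    obtain ⟨y, hy, hxy⟩ := hSt x hx
    refine mem_iUnion₂.2 ⟨y, hy, x - y, hq _ (by linarith), ?_⟩
    simp
  have h2 : IsCompact (closure S) := h1.closure.isCompact_of_isClosed isClosed_closure
  have h3 : IsCompact ((fun p : ℂ × E => p.1 • p.2) '' (Metric.closedBall 0 1 ×ˢ closure S)) :=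
    ((isCompact_closedBall _ _).prod h2).image continuous_smul
  set B := (fun p : ℂ × E => p.1 • p.2) '' (Metric.closedBall 0 1 ×ˢ closure S) with hB
  have hBb : Balanced ℂ B := by
    rw [balanced_iff_smul_mem]
    rintro a ha _ ⟨⟨c, x⟩, ⟨hc, hx⟩, rfl⟩
    refine ⟨(a * c, x), ⟨?_, hx⟩, mul_smul a c x⟩
    simp only [mem_closedBall_zero_iff, norm_mul] at hc ⊢
    exact mul_le_one₀ ha (norm_nonneg _) hc
  refine ⟨closure (convexHull ℝ B), ⟨?_, ?_, ?_⟩, ?_⟩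
  · exact (h3.totallyBounded.convexHull).closure.isCompact_of_isClosed isClosed_closure
  · exact (convex_convexHull ℝ B).closure
  · exact (balanced_convexHull hBb).closure
  · intro x hx
    refine subset_closure (subset_convexHull ℝ B ⟨(1, x), ⟨by simp, subset_closure hx⟩, ?_⟩)
    simp

/-- The functionals dominated by a seminorm, as a set of functions. -/
def seminormPolar {G : Type*} [AddCommGroup G] [Module ℂ G] (q : Seminorm ℂ G) : Set (G → ℂ) :=
  {g | (∀ x, ‖g x‖ ≤ q x) ∧ (∀ x y, g (x + y) = g x + g y) ∧ ∀ (c : ℂ) x, g (c • x) = c * g x}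

theorem isClosed_iInter_of {ι X : Type*} [TopologicalSpace X] {p : ι → X → Prop}
    (h : ∀ i, IsClosed {x | p i x}) : IsClosed {x | ∀ i, p i x} := by
  rw [ofPred_forall]
  exact isClosed_iInter h

/-- Banach–Alaoglu, for pointwise convergence. -/
theorem isCompact_seminormPolar {G : Type*} [AddCommGroup G] [Module ℂ G] (q : Seminorm ℂ G) :
    IsCompact (seminormPolar q) := by
  refine (isCompact_univ_pi fun x => isCompact_closedBall (0 : ℂ) (q x)).of_isClosed_subset ?_ ?_
  · refine IsClosed.inter ?_ (IsClosed.inter ?_ ?_)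
    · exact isClosed_iInter_of (fun x : G => isClosed_le (continuous_apply x).norm continuous_const)
    · exact isClosed_iInter_of fun x : G => isClosed_iInter_of fun y : G =>
        isClosed_eq (by fun_prop) (by fun_prop)
    · exact isClosed_iInter_of fun c : ℂ => isClosed_iInter_of fun y : G =>
        isClosed_eq (continuous_apply _) (continuous_const.mul (continuous_apply _))
  · exact fun g hg x _ => by simpa using hg.1 x

/-! ### Smooth functions -/

theorem eq_sum_single {d : ℕ} (v : Rd d) : v = ∑ i, v i • EuclideanSpace.single i (1 : ℝ) := by
  ext j
  simp [Pi.single_apply]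

section SmoothCriteria

set_option linter.unusedSectionVars false

variable {d : ℕ} {E : Type*} [AddCommGroup E] [Module ℂ E] [TopologicalSpace E] [T2Space E]
  [IsTopologicalAddGroup E] [ContinuousSMul ℂ E]

theorem IsSmooth.hasPartialDerivAt {f : Rd d → E} (hf : IsSmooth f) (w : List (Fin d)) (i : Fin d)
    (x : Rd d) : HasPartialDerivAt i (iterPartial w f) (iterPartial (i :: w) f x) x :=
  hasPartialDerivAt_of_exists ((hf w).2 i x)

theorem iterPartial_eq_of_family {f : Rd d → E} (y : List (Fin d) → Rd d → E) (h0 : y [] = f)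
    (hy : ∀ w i x, HasPartialDerivAt i (y w) (y (i :: w) x) x) (w : List (Fin d)) :
    iterPartial w f = y w := by
  induction w with
  | nil => exact h0.symm
  | cons i w ih =>
    funext x
    rw [iterPartial, ih]
    exact (hy w i x).eq

theorem isSmooth_of_family {f : Rd d → E} (y : List (Fin d) → Rd d → E) (h0 : y [] = f)
    (hc : ∀ w, Continuous (y w)) (hy : ∀ w i x, HasPartialDerivAt i (y w) (y (i :: w) x) x) :
    IsSmooth f := fun w => by
  rw [iterPartial_eq_of_family y h0 hy]
  exact ⟨hc w, fun i x => ⟨_, hy w i x⟩⟩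

theorem iterPartial_append (f : Rd d → E) (u v : List (Fin d)) :
    iterPartial (u ++ v) f = iterPartial u (iterPartial v f) := by
  induction u with
  | nil => rfl
  | cons i u ih => rw [List.cons_append, iterPartial, iterPartial, ih]

theorem IsSmooth.isSmooth_iterPartial {f : Rd d → E} (hf : IsSmooth f) (v : List (Fin d)) :
    IsSmooth (iterPartial v f) := fun w => by
  rw [← iterPartial_append]
  exact hf _

theorem HasPartialDerivAt.clm_comp {i : Fin d} {f : Rd d → E} {y : E} {x : Rd d}
    (e : E →L[ℂ] ℂ) (h : HasPartialDerivAt i f y x) :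
    HasPartialDerivAt i (fun z => e (f z)) (e y) x := by
  refine ((e.continuous.tendsto y).comp h).congr fun t => ?_
  simp only [Function.comp_apply]
  rw [← Complex.coe_smul, map_smul, map_sub, Complex.coe_smul]

theorem IsSmooth.iterPartial_clm_comp {f : Rd d → E} (hf : IsSmooth f) (e : E →L[ℂ] ℂ)
    (w : List (Fin d)) : iterPartial w (fun z => e (f z)) =
      fun z => e (iterPartial w f z) :=
  iterPartial_eq_of_family (fun w z => e (iterPartial w f z)) rfl
    (fun w i x => (hf.hasPartialDerivAt w i x).clm_comp e) w

theorem IsSmooth.clm_comp {f : Rd d → E} (hf : IsSmooth f) (e : E →L[ℂ] ℂ) :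
    IsSmooth fun z => e (f z) :=
  isSmooth_of_family (fun w z => e (iterPartial w f z)) rfl
    (fun w => e.continuous.comp (hf w).1)
    (fun w i x => (hf.hasPartialDerivAt w i x).clm_comp e)

theorem IsSmooth.mDeriv_clm_comp {f : Rd d → E} (hf : IsSmooth f) (e : E →L[ℂ] ℂ)
    (α : Fin d → ℕ) (x : Rd d) : mDeriv α (fun z => e (f z)) x = e (mDeriv α f x) := by
  rw [mDeriv, mDeriv, hf.iterPartial_clm_comp, map_smul]

/-- A Lipschitz bound along the coordinate directions is one in all directions, by telescoping. -/
theorem seminorm_sub_le_of_coordinate_bound (q : Seminorm ℂ E) {g : Rd d → E} {C : ℝ}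
    (h : ∀ i x (t : ℝ), q (g (x + t • EuclideanSpace.single i (1 : ℝ)) - g x) ≤ C * |t|)
    (x v : Rd d) : q (g (x + v) - g x) ≤ C * ∑ i, |v i| := by
  classical
  have key : ∀ s : Finset (Fin d),
      q (g (x + ∑ i ∈ s, v i • EuclideanSpace.single i (1 : ℝ)) - g x) ≤ C * ∑ i ∈ s, |v i| := by
    intro s
    induction s using Finset.induction_on with
    | empty => simp
    | insert i s hi ih =>
      rw [Finset.sum_insert hi, Finset.sum_insert hi, mul_add, add_comm (v i • _), ← add_assoc]
      refine le_trans ?_ (add_le_add (h i (x + ∑ i ∈ s, v i • EuclideanSpace.single i (1 : ℝ))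
        (v i)) ih)
      refine le_trans (le_of_eq ?_) (map_add_le_add q _ _)
      congr 1
      abel
  have := key Finset.univ
  rwa [← eq_sum_single v] at this

end SmoothCriteria

section Scalar

variable {d : ℕ}

theorem hasPartialDerivAt_iff_hasDerivAt {i : Fin d} {f : Rd d → ℂ} {y : ℂ} {x : Rd d} :
    HasPartialDerivAt i f y x ↔
      HasDerivAt (fun s : ℝ => f (x + s • EuclideanSpace.single i (1 : ℝ))) y 0 := by
  rw [hasDerivAt_iff_tendsto_slope_zero]
  simp [HasPartialDerivAt]

theorem hasDerivAt_line {i : Fin d} {f g : Rd d → ℂ} (h : ∀ x, HasPartialDerivAt i f (g x) x)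
    (x : Rd d) (s : ℝ) :
    HasDerivAt (fun s : ℝ => f (x + s • EuclideanSpace.single i (1 : ℝ)))
      (g (x + s • EuclideanSpace.single i (1 : ℝ))) s := by
  have h1 := hasPartialDerivAt_iff_hasDerivAt.1 (h (x + s • EuclideanSpace.single i (1 : ℝ)))
  have h2 := HasDerivAt.comp_sub_const (x := s) (a := s) (f' := g _) (by rwa [sub_self])
  refine h2.congr_of_eventuallyEq (Eventually.of_forall fun t => ?_)
  simp only [add_assoc, ← add_smul]
  congr 3
  ring

theorem norm_sub_le_of_partial_bound {i : Fin d} {f g : Rd d → ℂ}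
    (h : ∀ x, HasPartialDerivAt i f (g x) x) {C : ℝ} (hC : ∀ x, ‖g x‖ ≤ C) (x : Rd d) (t : ℝ) :
    ‖f (x + t • EuclideanSpace.single i (1 : ℝ)) - f x‖ ≤ C * |t| := by
  have := convex_univ.norm_image_sub_le_of_norm_hasDerivWithin_le
    (fun s _ => (hasDerivAt_line h x s).hasDerivWithinAt) (fun s _ => hC _)
    (mem_univ (0 : ℝ)) (mem_univ t)
  simpa using this

theorem norm_slope_sub_le_of_partial_bound {i : Fin d} {f g k : Rd d → ℂ}
    (h : ∀ x, HasPartialDerivAt i f (g x) x) (h' : ∀ x, HasPartialDerivAt i g (k x) x) {C : ℝ}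
    (hC : ∀ x, ‖k x‖ ≤ C) (x : Rd d) (t : ℝ) (ht : t ≠ 0) :
    ‖t⁻¹ • (f (x + t • EuclideanSpace.single i (1 : ℝ)) - f x) - g x‖ ≤ C * |t| := by
  have hC0 : 0 ≤ C := (norm_nonneg _).trans (hC x)
  have := (convex_uIcc (0 : ℝ) t).norm_image_sub_le_of_norm_hasDerivWithin_le
    (f := fun s : ℝ => f (x + s • EuclideanSpace.single i (1 : ℝ)) - s • g x)
    (fun s _ => ((hasDerivAt_line h x s).sub
      ((hasDerivAt_id s).smul_const (g x))).hasDerivWithinAt)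
    (C := C * |t|) (fun s hs => by
      simp only [one_smul]
      refine (norm_sub_le_of_partial_bound h' hC x s).trans
        (mul_le_mul_of_nonneg_left ?_ hC0)
      simpa using abs_sub_left_of_mem_uIcc hs)
    left_mem_uIcc right_mem_uIcc
  have h2 : t⁻¹ • (f (x + t • EuclideanSpace.single i (1 : ℝ)) - f x) - g x =
      t⁻¹ • (f (x + t • EuclideanSpace.single i (1 : ℝ)) - t • g x - (f x)) := by
    rw [sub_right_comm, smul_sub _ _ (t • g x), inv_smul_smul₀ ht]
  rw [h2, norm_smul, norm_inv, Real.norm_eq_abs, inv_mul_le_iff₀ (abs_pos.2 ht), mul_comm]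
  simpa using this

/-- The second difference of `f` in two directions is approximated by a mixed partial
derivative. -/
theorem norm_second_difference_le {i j : Fin d} {f g k : Rd d → ℂ}
    (hf : ∀ x, HasPartialDerivAt i f (g x) x) (hg : ∀ x, HasPartialDerivAt j g (k x) x)
    (hk : Continuous k) (x : Rd d) {ε : ℝ} (hε : 0 < ε) :
    ∃ δ > 0, ∀ t : ℝ, 0 < t → t < δ →
      ‖f (x + t • EuclideanSpace.single i (1 : ℝ) + t • EuclideanSpace.single j (1 : ℝ)) -
        f (x + t • EuclideanSpace.single i (1 : ℝ)) -
        f (x + t • EuclideanSpace.single j (1 : ℝ)) + f x - (t * t) • k x‖ ≤ ε * (t * t) := by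
  obtain ⟨δ, hδ, hk'⟩ := Metric.continuousAt_iff.1 (hk.continuousAt (x := x)) ε hε
  refine ⟨δ / 2, by positivity, fun t ht htδ => ?_⟩
  set a : Rd d := EuclideanSpace.single i (1 : ℝ) with ha
  set b : Rd d := EuclideanSpace.single j (1 : ℝ) with hb
  have hna : ‖a‖ = 1 := by simp [ha]
  have hnb : ‖b‖ = 1 := by simp [hb]
  have hg1 : ∀ s ∈ Icc 0 t, ‖g (x + s • a + t • b) - g (x + s • a) - t • k x‖ ≤ ε * t := by
    intro s hs
    have := norm_image_sub_le_of_norm_deriv_le_segment' (a := 0) (b := t) (C := ε)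
      (f := fun r : ℝ => g (x + s • a + r • b) - r • k x)
      (f' := fun r => k (x + s • a + r • b) - (1 : ℝ) • k x)
      (fun r _ => ((hasDerivAt_line hg (x + s • a) r).sub
        ((hasDerivAt_id r).smul_const (k x))).hasDerivWithinAt)
      (fun r hr => by
        rw [one_smul, ← dist_eq_norm]
        refine (hk' ?_).le
        rw [dist_eq_norm, add_assoc, add_sub_cancel_left]
        refine (norm_add_le _ _).trans_lt ?_
        rw [norm_smul, norm_smul, hna, hnb, Real.norm_of_nonneg hs.1, Real.norm_of_nonneg hr.1]
        linarith [hs.2, hr.2]) t (right_mem_Icc.2 ht.le)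
    simp only [zero_smul, add_zero, sub_zero] at this
    rwa [sub_right_comm] at this
  have := norm_image_sub_le_of_norm_deriv_le_segment' (a := 0) (b := t) (C := ε * t)
      (f := fun s : ℝ => f (x + t • b + s • a) - f (x + s • a) - s • t • k x)
      (f' := fun s => g (x + t • b + s • a) - g (x + s • a) - (1 : ℝ) • t • k x)
      (fun s _ => (((hasDerivAt_line hf (x + t • b) s).sub (hasDerivAt_line hf x s)).sub
        ((hasDerivAt_id s).smul_const (t • k x))).hasDerivWithinAt)
      (fun s hs => by
        rw [one_smul, add_right_comm]
        exact hg1 s ⟨hs.1, hs.2.le⟩) t (right_mem_Icc.2 ht.le)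
  simp only [zero_smul, add_zero, sub_zero] at this
  rw [← mul_assoc]
  refine le_trans (le_of_eq ?_) this
  congr 1
  rw [add_right_comm, smul_smul]
  ring

/-- Symmetry of mixed partial derivatives: both are limits of the same second difference
quotient. -/
theorem IsSmooth.partialDeriv_comm {f : Rd d → ℂ} (hf : IsSmooth f) (i j : Fin d) :
    partialDeriv i (partialDeriv j f) = partialDeriv j (partialDeriv i f) := by
  funext x
  by_contra hne
  set c := partialDeriv i (partialDeriv j f) x with hc
  set c' := partialDeriv j (partialDeriv i f) x with hc'
  have hpos : 0 < ‖c - c'‖ := norm_pos_iff.2 (sub_ne_zero.2 hne)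
  obtain ⟨δ, hδ, h⟩ := norm_second_difference_le (fun x => hf.hasPartialDerivAt [] j x)
    (fun x => hf.hasPartialDerivAt [j] i x) (hf [i, j]).1 x
    (show 0 < ‖c - c'‖ / 4 by positivity)
  obtain ⟨δ', hδ', h'⟩ := norm_second_difference_le (fun x => hf.hasPartialDerivAt [] i x)
    (fun x => hf.hasPartialDerivAt [i] j x) (hf [j, i]).1 x
    (show 0 < ‖c - c'‖ / 4 by positivity)
  obtain ⟨t, ht, ht'⟩ := exists_between (lt_min hδ hδ')
  have h1 := h t ht (ht'.trans_le (min_le_left _ _))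
  have h2 := h' t ht (ht'.trans_le (min_le_right _ _))
  have e1 : iterPartial [i, j] f x = c := rfl
  have e2 : iterPartial [j, i] f x = c' := rfl
  rw [e1] at h1
  rw [e2] at h2
  rw [add_right_comm x (t • _)] at h2
  have h3 := (norm_sub_le _ _).trans (add_le_add h2 h1)
  rw [show ∀ a b₁ b₂ y : ℂ, (a - b₁ - b₂ + y - (t * t) • c') - (a - b₂ - b₁ + y - (t * t) • c) =
    (t * t) • (c - c') from fun a b₁ b₂ y => by rw [smul_sub]; ring] at h3
  rw [norm_smul, Real.norm_of_nonneg (by positivity)] at h3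
  have : 0 < t * t * ‖c - c'‖ := by positivity
  linarith

theorem IsSmooth.iterPartial_perm {f : Rd d → ℂ} (hf : IsSmooth f) {u v : List (Fin d)}
    (h : u.Perm v) : iterPartial u f = iterPartial v f := by
  induction h with
  | nil => rfl
  | cons i _ ih => rw [iterPartial, iterPartial, ih]
  | swap i j w => exact (hf.isSmooth_iterPartial w).partialDeriv_comm j i
  | trans _ _ ih1 ih2 => exact ih1.trans ih2

end Scalar

section Lists

variable {d : ℕ}

/-- The list of differentiations which stands for a multi-index. -/
def indexList (α : Fin d → ℕ) : List (Fin d) :=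
  (List.finRange d).flatMap fun i => List.replicate (α i) i

theorem length_indexList (α : Fin d → ℕ) : (indexList α).length = len α := by
  simp [indexList, List.length_flatMap, len, Fin.sum_univ_def]

theorem count_indexList (α : Fin d → ℕ) (i : Fin d) : (indexList α).count i = α i := by
  rw [indexList, List.count_flatMap]
  have : (List.count i ∘ fun j => List.replicate (α j) j) = fun j => if j = i then α j else 0 := by
    funext j
    simp [List.count_replicate]
  rw [this, ← Fin.sum_univ_def]
  simp

theorem perm_indexList (w : List (Fin d)) : w.Perm (indexList fun i => w.count i) := by
  rw [List.perm_iff_count]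
  intro i
  rw [count_indexList]

theorem len_count (w : List (Fin d)) : len (fun i => w.count i) = w.length := by
  rw [← length_indexList, (perm_indexList w).length_eq]

theorem norm_iterPartial_eq {f : Rd d → ℂ} (hf : IsSmooth f) (w : List (Fin d)) (x : Rd d) :
    ‖iterPartial w f x‖ = ‖mDeriv (fun i => w.count i) f x‖ := by
  rw [hf.iterPartial_perm (perm_indexList w), mDeriv, norm_smul]
  simp [indexList]

theorem norm_mDeriv_eq (f : Rd d → ℂ) (α : Fin d → ℕ) (x : Rd d) :
    ‖mDeriv α f x‖ = ‖iterPartial (indexList α) f x‖ := by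
  rw [mDeriv, norm_smul]
  simp [indexList]

/-- All ways of distributing the entries of a list over two sublists. -/
def splits {ι : Type*} : List ι → List (List ι × List ι)
  | [] => [([], [])]
  | i :: w => (splits w).map (fun p => (i :: p.1, p.2)) ++ (splits w).map (fun p => (p.1, i :: p.2))

theorem length_splits {ι : Type*} (w : List ι) : (splits w).length = 2 ^ w.length := by
  induction w with
  | nil => rfl
  | cons i w ih => simp [splits, ih, pow_succ]; ring

theorem length_add_of_mem_splits {ι : Type*} {w : List ι} {p : List ι × List ι}
    (hp : p ∈ splits w) : p.1.length + p.2.length = w.length := by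
  induction w generalizing p with
  | nil => simp [splits] at hp; simp [hp]
  | cons i w ih =>
    simp only [splits, List.mem_append, List.mem_map] at hp
    rcases hp with ⟨p', hp', rfl⟩ | ⟨p', hp', rfl⟩ <;> have := ih hp' <;> simp <;> omega

end Lists

section Leibniz

variable {d : ℕ}

theorem HasPartialDerivAt.mul {i : Fin d} {f g : Rd d → ℂ} {y z : ℂ} {x : Rd d}
    (hf : HasPartialDerivAt i f y x) (hg : HasPartialDerivAt i g z x) :
    HasPartialDerivAt i (fun x => f x * g x) (y * g x + f x * z) x := by
  rw [hasPartialDerivAt_iff_hasDerivAt] at *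
  have := hf.mul hg
  simp only [zero_smul, add_zero] at this
  exact this

theorem HasPartialDerivAt.list_sum {ι : Type*} {i : Fin d} (l : List ι) {f : ι → Rd d → ℂ}
    {y : ι → ℂ} {x : Rd d} (h : ∀ k, HasPartialDerivAt i (f k) (y k) x) :
    HasPartialDerivAt i (fun x => (l.map fun k => f k x).sum) (l.map y).sum x := by
  induction l with
  | nil => simp [HasPartialDerivAt]
  | cons k l ih => simpa using! (h k).add ih

/-- The right-hand side of the Leibniz formula for `∂_w (f g)`; the factors are differentiated along
complementary sublists of `w`. -/
def leibnizSum (f g : Rd d → ℂ) (w : List (Fin d)) (x : Rd d) : ℂ :=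
  ((splits w).map fun p => iterPartial p.1 f x * iterPartial p.2 g x).sum

theorem hasPartialDerivAt_leibnizSum {f g : Rd d → ℂ} (hf : IsSmooth f) (hg : IsSmooth g)
    (w : List (Fin d)) (i : Fin d) (x : Rd d) :
    HasPartialDerivAt i (leibnizSum f g w) (leibnizSum f g (i :: w) x) x := by
  have := HasPartialDerivAt.list_sum (splits w) (x := x) (i := i) fun p =>
    (hf.hasPartialDerivAt p.1 i x).mul (hg.hasPartialDerivAt p.2 i x)
  convert! this using 1
  simp [leibnizSum, splits, Function.comp_def, List.sum_map_add]

theorem IsSmooth.iterPartial_mul {f g : Rd d → ℂ} (hf : IsSmooth f) (hg : IsSmooth g)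
    (w : List (Fin d)) : iterPartial w (fun x => f x * g x) = leibnizSum f g w :=
  iterPartial_eq_of_family (leibnizSum f g) (by funext x; simp [leibnizSum, splits, iterPartial])
    (hasPartialDerivAt_leibnizSum hf hg) w

theorem IsSmooth.mul {f g : Rd d → ℂ} (hf : IsSmooth f) (hg : IsSmooth g) :
    IsSmooth fun x => f x * g x :=
  isSmooth_of_family (leibnizSum f g) (by funext x; simp [leibnizSum, splits, iterPartial])
    (fun w => continuous_list_sum _ fun p _ => (hf _).1.mul (hg _).1)
    (hasPartialDerivAt_leibnizSum hf hg)

/-- A Leibniz estimate at a point, for weights `N` with `N p * N q ≤ N (p + q)`. -/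
theorem norm_iterPartial_mul_le {f g : Rd d → ℂ} (hf : IsSmooth f) (hg : IsSmooth g)
    {N : ℕ → ℝ} (hN : ∀ p, 0 ≤ N p) (hNN : ∀ p q, N p * N q ≤ N (p + q)) {x : Rd d} {A B : ℝ}
    (hA : ∀ w, ‖iterPartial w f x‖ ≤ A * N w.length)
    (hB : ∀ w, ‖iterPartial w g x‖ ≤ B * N w.length) (hA0 : 0 ≤ A) (hB0 : 0 ≤ B)
    (w : List (Fin d)) :
    ‖iterPartial w (fun x => f x * g x) x‖ ≤ 2 ^ w.length * (A * B * N w.length) := by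
  rw [hf.iterPartial_mul hg, leibnizSum]
  have h1 : ∀ l : List (List (Fin d) × List (Fin d)), (∀ p ∈ l, p ∈ splits w) →
      ‖(l.map fun p => iterPartial p.1 f x * iterPartial p.2 g x).sum‖ ≤
        l.length * (A * B * N w.length) := by
    intro l
    induction l with
    | nil => simp
    | cons p l ih =>
      intro hl
      rw [List.map_cons, List.sum_cons, List.length_cons]
      refine (norm_add_le _ _).trans ?_
      have h2 := ih fun q hq => hl q (List.mem_cons_of_mem _ hq)
      have h3 : ‖iterPartial p.1 f x * iterPartial p.2 g x‖ ≤ A * B * N w.length := by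
        rw [norm_mul]
        calc _ ≤ (A * N p.1.length) * (B * N p.2.length) :=
              mul_le_mul (hA _) (hB _) (norm_nonneg _) (mul_nonneg hA0 (hN _))
          _ = A * B * (N p.1.length * N p.2.length) := by ring
          _ ≤ A * B * N w.length := by
              refine mul_le_mul_of_nonneg_left ?_ (mul_nonneg hA0 hB0)
              rw [← length_add_of_mem_splits (hl p List.mem_cons_self)]
              exact hNN _ _
      push_cast
      linarith
  refine (h1 _ fun p hp => hp).trans (le_of_eq ?_)
  rw [length_splits]
  norm_num

end Leibniz

/-- The derivatives vanish on an open set on which the function vanishes. -/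
theorem iterPartial_eq_zero_of_isOpen {d : ℕ} {E : Type*} [AddCommGroup E] [Module ℂ E]
    [TopologicalSpace E] [T2Space E] {f : Rd d → E} {U : Set (Rd d)}
    (hU : IsOpen U) (hf : ∀ x ∈ U, f x = 0) (w : List (Fin d)) :
    ∀ x ∈ U, iterPartial w f x = 0 := by
  induction w with
  | nil => exact hf
  | cons i w ih =>
    intro x hx
    refine HasPartialDerivAt.eq ?_
    refine tendsto_const_nhds.congr' ?_
    have hc : Continuous fun h : ℝ => x + h • EuclideanSpace.single i (1 : ℝ) := by fun_prop
    have : ∀ᶠ h : ℝ in 𝓝 0, x + h • EuclideanSpace.single i (1 : ℝ) ∈ U :=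
      hc.continuousAt.eventually (by simpa using hU.mem_nhds hx)
    filter_upwards [nhdsWithin_le_nhds this] with h hh
    rw [ih _ hh, ih _ hx, sub_zero, smul_zero]

/-! ### Compactly supported ultradifferentiable functions -/

section Cutoff

/-- The average of `f` over `[x - c, x]`. -/
def average (c : ℝ) (f : ℝ → ℝ) (x : ℝ) : ℝ := ∫ t in (0 : ℝ)..1, f (x - c * t)

theorem hasDerivAt_average {c : ℝ} (hc : 0 < c) {f : ℝ → ℝ} (hf : Continuous f) (x : ℝ) :
    HasDerivAt (average c f) ((f x - f (x - c)) / c) x := by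
  have h1 : average c f = fun x =>
      c⁻¹ * ((∫ t in (0 : ℝ)..x, f t) - ∫ t in (0 : ℝ)..(x - c), f t) := by
    funext x
    rw [average, intervalIntegral.integral_comp_sub_mul _ hc.ne', smul_eq_mul,
      intervalIntegral.integral_interval_sub_left (hf.intervalIntegrable _ _)
        (hf.intervalIntegrable _ _)]
    simp
  rw [h1, div_eq_inv_mul]
  have h2 : ∀ y, HasDerivAt (fun y => ∫ t in (0 : ℝ)..y, f t) (f y) y := fun y =>
    intervalIntegral.integral_hasDerivAt_right (hf.intervalIntegrable _ _)
      hf.stronglyMeasurable.stronglyMeasurableAtFilter hf.continuousAt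
  exact ((h2 x).sub ((h2 (x - c)).comp_sub_const x c)).const_mul _

theorem abs_average_sub_le {c C : ℝ} {f g : ℝ → ℝ} (hf : Continuous f) (hg : Continuous g)
    {x y : ℝ} (h : ∀ t ∈ Icc (0 : ℝ) 1, |f (x - c * t) - g (y - c * t)| ≤ C) :
    |average c f x - average c g y| ≤ C := by
  rw [average, average, ← intervalIntegral.integral_sub
    (Continuous.intervalIntegrable (by fun_prop) _ _)
    (Continuous.intervalIntegrable (by fun_prop) _ _)]
  have := intervalIntegral.norm_integral_le_of_norm_le_const (a := (0 : ℝ)) (b := 1) (C := C)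
    (f := fun t => f (x - c * t) - g (y - c * t)) (fun t ht => by
      rw [uIoc_of_le zero_le_one] at ht
      exact h t ⟨ht.1.le, ht.2⟩)
  simpa using this

/-- A trapezoid: `1` on `[-2, 2]` and `0` outside of `[-3, 3]`. -/
def trapezoid (x : ℝ) : ℝ := max 0 (min 1 (3 - |x|))

/-- The trapezoid, averaged over intervals of the lengths `a 0, …, a (n - 1)`. -/
def averages : ℕ → (ℕ → ℝ) → ℝ → ℝ
  | 0, _ => trapezoid
  | n + 1, a => average (a 0) (averages n fun j => a (j + 1))

theorem continuous_of_abs_sub_le {f : ℝ → ℝ} (h : ∀ x y, |f x - f y| ≤ |x - y|) :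
    Continuous f :=
  (LipschitzWith.of_dist_le_mul (K := 1) fun x y => by simpa [Real.dist_eq] using h x y).continuous

theorem abs_averages_sub_le (n : ℕ) (a : ℕ → ℝ) :
    ∀ x y, |averages n a x - averages n a y| ≤ |x - y| := by
  induction n generalizing a with
  | zero =>
    intro x y
    refine (abs_max_sub_max_le_max _ _ _ _).trans (max_le (by simp) ?_)
    refine (abs_min_sub_min_le_max _ _ _ _).trans (max_le (by simp) ?_)
    rw [sub_sub_sub_cancel_left, abs_sub_comm x]
    exact abs_abs_sub_abs_le y x
  | succ n ih =>
    intro x y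
    have hc : Continuous (averages n fun j => a (j + 1)) := continuous_of_abs_sub_le (ih _)
    refine abs_average_sub_le hc hc fun t _ => (ih _ _ _).trans (le_of_eq ?_)
    congr 1
    ring

theorem continuous_averages (n : ℕ) (a : ℕ → ℝ) : Continuous (averages n a) :=
  continuous_of_abs_sub_le (abs_averages_sub_le n a)

theorem averages_eq_of_eqOn (n : ℕ) {a : ℕ → ℝ} (ha : ∀ j, 0 < a j) {x κ : ℝ}
    (h : ∀ y, x - ∑ j ∈ Finset.range n, a j ≤ y → y ≤ x → trapezoid y = κ) :
    averages n a x = κ := by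
  induction n generalizing a x with
  | zero => exact h x (by simp) le_rfl
  | succ n ih =>
    rw [averages, average]
    have : ∀ t ∈ uIcc (0 : ℝ) 1, averages n (fun j => a (j + 1)) (x - a 0 * t) = κ := by
      intro t ht
      rw [uIcc_of_le zero_le_one] at ht
      refine ih (fun j => ha _) fun y hy hy' => h y ?_ ?_
      · rw [Finset.sum_range_succ']
        nlinarith [ht.2, ha 0]
      · nlinarith [ht.1, ha 0]
    rw [intervalIntegral.integral_congr this]
    simp

theorem abs_averages_le (n : ℕ) (a : ℕ → ℝ) (x : ℝ) : |averages n a x| ≤ 1 := by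
  induction n generalizing a x with
  | zero =>
    simp only [averages, trapezoid]
    rw [abs_of_nonneg (le_max_left _ _)]
    exact max_le zero_le_one (min_le_left _ _)
  | succ n ih =>
    have := intervalIntegral.norm_integral_le_of_norm_le_const (a := (0 : ℝ)) (b := 1) (C := 1)
      (f := fun t => averages n (fun j => a (j + 1)) (x - a 0 * t)) (fun t _ => ih _ _)
    simpa [averages, average] using this

theorem abs_averages_succ_sub_le (n : ℕ) {a : ℕ → ℝ} (ha : ∀ j, 0 < a j) (x : ℝ) :
    |averages (n + 1) a x - averages n a x| ≤ a n := by
  induction n generalizing a x with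
  | zero =>
    have := abs_averages_sub_le 0 a
    change |(∫ t in (0 : ℝ)..1, averages 0 a (x - a 0 * t)) - averages 0 a x| ≤ a 0
    have e : averages 0 a x = ∫ t in (0 : ℝ)..1, averages 0 a x := by simp
    conv_lhs => rw [e]
    rw [← intervalIntegral.integral_sub (f := fun t : ℝ => averages 0 a (x - a 0 * t))
      (((continuous_averages 0 a).comp
        (by fun_prop : Continuous fun t : ℝ => x - a 0 * t)).intervalIntegrable _ _)
      intervalIntegrable_const]
    have := intervalIntegral.norm_integral_le_of_norm_le_const (a := (0 : ℝ)) (b := 1) (C := a 0)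
      (f := fun t => averages 0 a (x - a 0 * t) - averages 0 a x) (fun t ht => by
        rw [uIoc_of_le zero_le_one] at ht
        refine (this _ _).trans ?_
        rw [sub_sub_cancel_left, abs_neg, abs_of_nonneg (by nlinarith [ht.1, ha 0])]
        nlinarith [ht.2, ha 0])
    simpa using this
  | succ n ih =>
    exact abs_average_sub_le (continuous_averages _ _) (continuous_averages _ _)
      fun t _ => ih (fun j => ha _) _

/-- The limit of the averages of the trapezoid, a smooth cutoff function. The limit exists if `a`
is summable. -/
def smoothStep (a : ℕ → ℝ) (x : ℝ) : ℝ := limUnder atTop fun n => averages n a x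

variable {a : ℕ → ℝ} (ha : ∀ j, 0 < a j) (hs : Summable a)

include ha hs

theorem tendsto_averages (x : ℝ) :
    Tendsto (fun n => averages n a x) atTop (𝓝 (smoothStep a x)) := by
  refine (cauchySeq_of_dist_le_of_summable a (fun n => ?_) hs).tendsto_limUnder
  rw [dist_comm, Real.dist_eq]
  exact abs_averages_succ_sub_le n ha x

theorem continuous_smoothStep : Continuous (smoothStep a) := by
  refine continuous_of_abs_sub_le fun x y => ?_
  exact le_of_tendsto ((tendsto_averages ha hs x).sub (tendsto_averages ha hs y)).abs
    (Eventually.of_forall fun n => abs_averages_sub_le n a x y)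

theorem abs_smoothStep_le (x : ℝ) : |smoothStep a x| ≤ 1 :=
  le_of_tendsto (tendsto_averages ha hs x).abs (Eventually.of_forall fun n => abs_averages_le n a x)

theorem smoothStep_eq_average :
    smoothStep a = average (a 0) (smoothStep fun j => a (j + 1)) := by
  funext x
  have hs' : Summable fun j => a (j + 1) := (summable_nat_add_iff 1).2 hs
  refine tendsto_nhds_unique ((tendsto_averages ha hs x).comp (tendsto_add_atTop_nat 1)) ?_
  refine intervalIntegral.tendsto_integral_filter_of_dominated_convergence (fun _ => 1)
    (Eventually.of_forall fun n => ?_) (Eventually.of_forall fun n => ?_) ?_ ?_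
  · exact ((continuous_averages n _).comp (by fun_prop)).aestronglyMeasurable
  · exact Eventually.of_forall fun t _ => abs_averages_le n _ _
  · exact intervalIntegrable_const
  · exact Eventually.of_forall fun t _ => tendsto_averages (fun j => ha _) hs' _

theorem smoothStep_eq_of_eqOn (hs1 : ∑' j, a j ≤ 1) {x κ : ℝ}
    (h : ∀ y, x - 1 ≤ y → y ≤ x → trapezoid y = κ) : smoothStep a x = κ := by
  refine tendsto_nhds_unique (tendsto_averages ha hs x) (tendsto_const_nhds.congr fun n => ?_)
  refine (averages_eq_of_eqOn n ha fun y hy => h y ?_).symm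
  have := hs.sum_le_tsum (Finset.range n) fun j _ => (ha j).le
  linarith

omit ha hs

/-- The derivatives of `smoothStep`: each differentiation turns one averaging operator into a
difference quotient. -/
def smoothStepDeriv : ℕ → (ℕ → ℝ) → ℝ → ℝ
  | 0, a => smoothStep a
  | k + 1, a => fun x => (smoothStepDeriv k (fun j => a (j + 1)) x -
      smoothStepDeriv k (fun j => a (j + 1)) (x - a 0)) / a 0

include ha hs

theorem hasDerivAt_smoothStepDeriv (k : ℕ) (x : ℝ) :
    HasDerivAt (smoothStepDeriv k a) (smoothStepDeriv (k + 1) a x) x := by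
  have hs' : Summable fun j => a (j + 1) := (summable_nat_add_iff 1).2 hs
  induction k generalizing a x with
  | zero =>
    rw [smoothStepDeriv, smoothStep_eq_average ha hs]
    exact hasDerivAt_average (ha 0) (continuous_smoothStep (fun j => ha _) hs') x
  | succ k ih =>
    have hs'' : Summable fun j => a (j + 1 + 1) := (summable_nat_add_iff 1).2 hs'
    have h := ih (fun j => ha _) hs' (hs' := hs'')
    exact ((h x).sub ((h (x - a 0)).comp_sub_const x (a 0))).div_const _

theorem abs_smoothStepDeriv_le (k : ℕ) (x : ℝ) :
    |smoothStepDeriv k a x| ≤ ∏ j ∈ Finset.range k, (2 / a j) := by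
  induction k generalizing a x with
  | zero => simpa [smoothStepDeriv] using abs_smoothStep_le ha hs x
  | succ k ih =>
    have h := ih (fun j => ha (j + 1)) ((summable_nat_add_iff 1).2 hs)
    rw [smoothStepDeriv, abs_div, abs_of_pos (ha 0), Finset.prod_range_succ',
      div_le_iff₀ (ha 0), mul_assoc, div_mul_cancel₀ _ (ha 0).ne', mul_two]
    exact (abs_sub _ _).trans (add_le_add (h _) (h _))

end Cutoff

theorem WeightSequence.summable (W : WeightSequence) : Summable fun j => W.M j / W.M (j + 1) := by
  obtain ⟨c₀, H, -, -, -, h⟩ := W.m23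
  refine (summable_nat_add_iff 1).1 ((h 1 le_rfl).1.congr fun k => ?_)
  rw [add_comm 1 k]

/-- The Denjoy–Carleman theorem (the part that provides functions): there is a compactly supported
function of class `{M_p}`, equal to one near zero, given here with all its derivatives. -/
theorem WeightSequence.exists_cutoff (W : WeightSequence) :
    ∃ (φ : ℕ → ℝ → ℝ) (h : ℝ), 0 < h ∧ (∀ k x, HasDerivAt (φ k) (φ (k + 1) x) x) ∧
      (∀ k x, |φ k x| ≤ h ^ k * W.M k) ∧ (∀ x, |x| ≤ 1 → φ 0 x = 1) ∧
      ∀ x, 4 ≤ |x| → φ 0 x = 0 := by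
  set S := ∑' j, W.M j / W.M (j + 1) with hS
  have hS0 : 0 ≤ S := tsum_nonneg fun j => (div_pos (W.pos _) (W.pos _)).le
  have hS1 : 0 < 1 + S := by positivity
  set a : ℕ → ℝ := fun j => (1 + S)⁻¹ * (W.M j / W.M (j + 1)) with hadef
  have ha : ∀ j, 0 < a j := fun j =>
    mul_pos (by positivity) (div_pos (W.pos _) (W.pos _))
  have hs : Summable a := W.summable.mul_left _
  have hs1 : ∑' j, a j ≤ 1 := by
    rw [tsum_mul_left, inv_mul_le_iff₀ hS1]
    linarith
  have hprod : ∀ k, ∏ j ∈ Finset.range k, (2 / a j) = (2 * (1 + S)) ^ k * W.M k := by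
    intro k
    induction k with
    | zero => simp [W.zero]
    | succ k ih =>
      have h1 := (W.pos k).ne'
      have h2 := (W.pos (k + 1)).ne'
      rw [Finset.prod_range_succ, ih, hadef]
      field_simp
      ring
  refine ⟨fun k => smoothStepDeriv k a, 2 * (1 + S), by positivity,
    hasDerivAt_smoothStepDeriv ha hs, fun k x => ?_, fun x hx => ?_, fun x hx => ?_⟩
  · rw [← hprod]
    exact abs_smoothStepDeriv_le ha hs k x
  · refine smoothStep_eq_of_eqOn ha hs hs1 fun y hy hy' => ?_
    have : |y| ≤ 2 := abs_le.2 (by constructor <;> linarith [(abs_le.1 hx).1, (abs_le.1 hx).2])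
    rw [trapezoid, min_eq_left (by linarith), max_eq_right zero_le_one]
  · refine smoothStep_eq_of_eqOn ha hs hs1 fun y hy hy' => ?_
    have : 3 ≤ |y| := by
      rcases le_abs.1 hx with h | h
      · exact le_abs.2 (Or.inl (by linarith))
      · exact le_abs.2 (Or.inr (by linarith))
    rw [trapezoid, max_eq_left]
    exact (min_le_right _ _).trans (by linarith)

/-! ### Growth of the weights -/

/-- Komatsu's lemma: a sequence which is `O(T_k)` for every `(t_j)` in `𝔑` grows at most
geometrically. Otherwise one finds `k 0 < k 1 < ⋯` with `(n + 1) ^ (k n + 1) < a (k n)`, and the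
sequence which takes the value `n + 1` on `[k (n - 1), k n)` is a counterexample. -/
theorem exists_geometric_bound {a : ℕ → ℝ} (h : ∀ t : RSeq, ∃ C, ∀ k, a k ≤ C * t.T k) :
    ∃ r C : ℝ, 0 < r ∧ 0 < C ∧ ∀ k, a k ≤ C * r ^ k := by
  by_contra! hcon
  -- failure for the ratio `n + 1` occurs at arbitrarily large indices
  have hlarge : ∀ n m : ℕ, ∃ k, m < k ∧ ((n : ℝ) + 1) * ((n : ℝ) + 1) ^ k < a k := by
    intro n m
    have hn : (0 : ℝ) < n + 1 := by positivity
    obtain ⟨k, hk⟩ := hcon (n + 1) ((n + 1) + ∑ j ∈ Finset.range (m + 1), |a j|) hn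
      (by positivity)
    refine ⟨k, ?_, ?_⟩
    · by_contra! hkm
      have h1 : |a k| ≤ ∑ j ∈ Finset.range (m + 1), |a j| :=
        Finset.single_le_sum (f := fun j => |a j|) (fun j _ => abs_nonneg _)
          (Finset.mem_range.2 (by omega))
      have h2 : (1 : ℝ) ≤ ((n : ℝ) + 1) ^ k :=
        one_le_pow₀ (by linarith [Nat.cast_nonneg (α := ℝ) n])
      have h3 : |a k| ≤ ((n + 1) + ∑ j ∈ Finset.range (m + 1), |a j|) * ((n : ℝ) + 1) ^ k :=
        (h1.trans (by linarith)).trans (le_mul_of_one_le_right (by positivity) h2)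
      linarith [le_abs_self (a k)]
    · refine lt_of_le_of_lt (mul_le_mul_of_nonneg_right ?_ (by positivity)) hk
      have : 0 ≤ ∑ j ∈ Finset.range (m + 1), |a j| := Finset.sum_nonneg fun _ _ => abs_nonneg _
      linarith
  choose κ hκ1 hκ2 using hlarge
  let k : ℕ → ℕ := fun n => Nat.rec (κ 0 0) (fun n m => κ (n + 1) m) n
  have hk : StrictMono k := strictMono_nat_of_lt_succ fun n => hκ1 _ _
  have hak : ∀ n : ℕ, ((n : ℝ) + 1) * ((n : ℝ) + 1) ^ k n < a (k n) := by
    intro n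
    cases n with
    | zero => exact hκ2 0 0
    | succ n => exact hκ2 (n + 1) (k n)
  clear_value k
  let c : ℕ → ℕ := fun j => ((Finset.range (j + 1)).filter fun m : ℕ => k m ≤ j).card
  have hcmono : Monotone c := fun i j hij => Finset.card_le_card fun m hm => by
    simp only [Finset.mem_filter, Finset.mem_range] at hm ⊢
    exact ⟨by omega, by omega⟩
  have hclt : ∀ n j, j < k n → c j ≤ n := by
    intro n j hj
    refine (Finset.card_le_card fun m hm => ?_).trans (Finset.card_range n).le
    simp only [Finset.mem_filter, Finset.mem_range] at hm ⊢
    exact hk.lt_iff_lt.1 (hm.2.trans_lt hj)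
  have hcge : ∀ n, n ≤ c (k n) := by
    intro n
    refine (Finset.card_range n).ge.trans (Finset.card_le_card fun m hm => ?_)
    simp only [Finset.mem_filter, Finset.mem_range] at hm ⊢
    have := hk.id_le n
    exact ⟨by simp only [id] at this; omega, hk.monotone hm.le⟩
  let t : RSeq :=
    { t := fun j => c j + 1
      pos := fun j => by positivity
      mono := fun i j hij => by
        have : (c i : ℝ) ≤ c j := by exact_mod_cast hcmono hij
        linarith
      tendsto := by
        refine tendsto_atTop_add_const_right _ _ (tendsto_natCast_atTop_atTop.comp ?_)
        exact tendsto_atTop_atTop.2 fun n => ⟨k n, fun j hj => (hcge n).trans (hcmono hj)⟩ }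
  obtain ⟨C, hC⟩ := h t
  obtain ⟨n, hn⟩ := exists_nat_gt C
  have hT : t.T (k n) ≤ ((n : ℝ) + 1) ^ k n := by
    calc t.T (k n) ≤ ∏ j ∈ Finset.range (k n), ((n : ℝ) + 1) := by
          refine Finset.prod_le_prod (fun j _ => (t.pos j).le) fun j hj => ?_
          have : (c j : ℝ) ≤ n := by exact_mod_cast hclt n j (Finset.mem_range.1 hj)
          change (c j : ℝ) + 1 ≤ _
          linarith
      _ = _ := by simp
  have h1 : C * t.T (k n) ≤ ((n : ℝ) + 1) * ((n : ℝ) + 1) ^ k n :=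
    mul_le_mul (by linarith) hT (t.T_pos _).le (by positivity)
  linarith [hak n, hC (k n)]

/-- A geometric sequence is `O(T_k)` for every `(t_j)` in `𝔑`. -/
theorem RSeq.exists_pow_le (t : RSeq) {r : ℝ} (hr : 0 < r) :
    ∃ C, 0 < C ∧ ∀ k, r ^ k ≤ C * t.T k := by
  obtain ⟨n, hn⟩ := (t.tendsto.eventually_ge_atTop r).exists_forall_of_atTop
  have hpos : ∀ k, 0 < r ^ k / t.T k := fun k => div_pos (pow_pos hr k) (t.T_pos k)
  refine ⟨∑ k ∈ Finset.range (n + 1), r ^ k / t.T k,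
    Finset.sum_pos (fun k _ => hpos k) ⟨0, by simp⟩, fun k => ?_⟩
  rw [← div_le_iff₀ (t.T_pos k)]
  have hsmall : ∀ k ≤ n, r ^ k / t.T k ≤ ∑ k ∈ Finset.range (n + 1), r ^ k / t.T k :=
    fun k hk => Finset.single_le_sum (f := fun k => r ^ k / t.T k) (fun k _ => (hpos k).le)
      (Finset.mem_range.2 (by omega))
  rcases le_total k n with hk | hk
  · exact hsmall k hk
  · induction k, hk using Nat.le_induction with
    | base => exact hsmall n le_rfl
    | succ k hk ih =>
      refine le_trans ?_ ih
      rw [div_le_div_iff₀ (t.T_pos _) (t.T_pos _), RSeq.T, RSeq.T, Finset.prod_range_succ, pow_succ]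
      have := mul_le_mul_of_nonneg_left (hn k hk) (mul_pos (pow_pos hr k) (t.T_pos k)).le
      simp only [RSeq.T] at this ⊢
      linarith

theorem RSeq.T_mul_le (t : RSeq) (p q : ℕ) : t.T p * t.T q ≤ t.T (p + q) := by
  rw [RSeq.T, RSeq.T, RSeq.T, Finset.prod_range_add]
  refine mul_le_mul_of_nonneg_left (Finset.prod_le_prod (fun j _ => (t.pos j).le) fun j _ =>
    t.mono (by omega)) (t.T_pos p).le

theorem WeightSequence.M_mul_le (W : WeightSequence) (p q : ℕ) :
    W.M p * W.M q ≤ W.M (p + q) := by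
  have hratio : Monotone fun p => W.M (p + 1) / W.M p := by
    refine monotone_nat_of_le_succ fun p => ?_
    rw [div_le_div_iff₀ (W.pos _) (W.pos _)]
    have := W.m1 (p + 1) (by omega)
    simp only [add_tsub_cancel_right] at this
    nlinarith
  induction q with
  | zero => simp [W.zero]
  | succ q ih =>
    have h1 : W.M (q + 1) / W.M q ≤ W.M (p + q + 1) / W.M (p + q) := hratio (by omega)
    have h2 := mul_le_mul ih h1 (div_pos (W.pos _) (W.pos _)).le (W.pos _).le
    rw [mul_assoc, mul_div_cancel₀ _ (W.pos _).ne', mul_div_cancel₀ _ (W.pos _).ne'] at h2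
    exact h2

/-- The sequence `(t_j / c)`. -/
def RSeq.divConst (t : RSeq) (c : ℝ) (hc : 0 < c) : RSeq where
  t j := t.t j / c
  pos j := div_pos (t.pos j) hc
  mono _ _ h := div_le_div_of_nonneg_right (t.mono h) hc.le
  tendsto := t.tendsto.atTop_div_const hc

theorem RSeq.T_divConst (t : RSeq) {c : ℝ} (hc : 0 < c) (k : ℕ) :
    (t.divConst c hc).T k = t.T k / c ^ k := by
  simp [RSeq.T, RSeq.divConst, Finset.prod_div_distrib]

/-! ### Density of the test functions -/

section ProductCutoff

variable {d : ℕ} {φ : ℕ → ℝ → ℝ}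

/-- The derivatives of the function `x ↦ ∏ i, φ (x i / R)` on `ℝ^d`, where `φ k` stands for the
`k`-th derivative of `φ`. -/
def productCutoff (φ : ℕ → ℝ → ℝ) (R : ℝ) (w : List (Fin d)) (x : Rd d) : ℝ :=
  ∏ i, (R⁻¹ ^ w.count i * φ (w.count i) (x i / R))

theorem hasPartialDerivAt_productCutoff (hφ : ∀ k s, HasDerivAt (φ k) (φ (k + 1) s) s) {R : ℝ}
    (w : List (Fin d)) (j : Fin d) (x : Rd d) :
    HasPartialDerivAt j (fun x => (productCutoff φ R w x : ℂ))
      (productCutoff φ R (j :: w) x : ℂ) x := by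
  classical
  rw [hasPartialDerivAt_iff_hasDerivAt]
  refine HasDerivAt.ofReal_comp (f := fun s : ℝ =>
    productCutoff φ R w (x + s • EuclideanSpace.single j (1 : ℝ))) ?_
  set P : ℝ := ∏ i ∈ Finset.univ.erase j, (R⁻¹ ^ w.count i * φ (w.count i) (x i / R)) with hP
  have h1 : (fun s : ℝ => productCutoff φ R w (x + s • EuclideanSpace.single j (1 : ℝ))) =
      fun s => R⁻¹ ^ w.count j * φ (w.count j) ((x j + s) / R) * P := by
    funext s
    rw [productCutoff, ← Finset.mul_prod_erase _ _ (Finset.mem_univ j)]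
    congr 1
    · simp
    · refine Finset.prod_congr rfl fun i hi => ?_
      simp [Finset.ne_of_mem_erase hi]
  have h2 : productCutoff φ R (j :: w) x =
      R⁻¹ ^ w.count j * (φ (w.count j + 1) (x j / R) * R⁻¹) * P := by
    rw [productCutoff, ← Finset.mul_prod_erase _ _ (Finset.mem_univ j)]
    congr 1
    · simp only [List.count_cons_self, pow_succ]
      ring
    · refine Finset.prod_congr rfl fun i hi => ?_
      rw [List.count_cons_of_ne (Finset.ne_of_mem_erase hi).symm]
  rw [h1, h2]
  have h3 : HasDerivAt (fun s : ℝ => (x j + s) / R) R⁻¹ 0 := by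
    simpa using ((hasDerivAt_id (0 : ℝ)).const_add (x j)).div_const R
  have h4 := (hφ (w.count j) ((x j + 0) / R)).comp (0 : ℝ) h3
  rw [add_zero] at h4
  exact (h4.const_mul _).mul_const P

theorem continuous_productCutoff (hφ : ∀ k s, HasDerivAt (φ k) (φ (k + 1) s) s) {R : ℝ}
    (w : List (Fin d)) : Continuous (productCutoff φ R w) := by
  have hc : ∀ k, Continuous (φ k) := fun k =>
    continuous_iff_continuousAt.2 fun s => (hφ k s).continuousAt
  refine continuous_finsetProd _ fun i _ => continuous_const.mul ((hc _).comp ?_)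
  exact (EuclideanSpace.proj (𝕜 := ℝ) i).continuous.div_const R

theorem isSmooth_productCutoff (hφ : ∀ k s, HasDerivAt (φ k) (φ (k + 1) s) s) {R : ℝ} :
    IsSmooth fun x : Rd d => (productCutoff φ R [] x : ℂ) :=
  isSmooth_of_family (fun w x => (productCutoff φ R w x : ℂ)) rfl
    (fun w => Complex.continuous_ofReal.comp (continuous_productCutoff hφ w))
    (hasPartialDerivAt_productCutoff hφ)

theorem iterPartial_productCutoff (hφ : ∀ k s, HasDerivAt (φ k) (φ (k + 1) s) s) {R : ℝ}
    (w : List (Fin d)) :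
    iterPartial w (fun x : Rd d => (productCutoff φ R [] x : ℂ)) =
      fun x => (productCutoff φ R w x : ℂ) :=
  iterPartial_eq_of_family (fun w x => (productCutoff φ R w x : ℂ)) rfl
    (hasPartialDerivAt_productCutoff hφ) w

theorem hasPartialDerivAt_one_sub_productCutoff (hφ : ∀ k s, HasDerivAt (φ k) (φ (k + 1) s) s)
    {R : ℝ} (w : List (Fin d)) (j : Fin d) (x : Rd d) :
    HasPartialDerivAt j (fun x => (if w = [] then 1 else 0) - (productCutoff φ R w x : ℂ))
      ((if j :: w = [] then 1 else 0) - (productCutoff φ R (j :: w) x : ℂ)) x := by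
  have h1 := hasPartialDerivAt_productCutoff hφ (R := R) w j x
  rw [hasPartialDerivAt_iff_hasDerivAt] at *
  simpa using h1.const_sub (if w = [] then (1 : ℂ) else 0)

theorem isSmooth_one_sub_productCutoff (hφ : ∀ k s, HasDerivAt (φ k) (φ (k + 1) s) s) {R : ℝ} :
    IsSmooth fun x : Rd d => 1 - (productCutoff φ R [] x : ℂ) :=
  isSmooth_of_family (fun w x => (if w = [] then 1 else 0) - (productCutoff φ R w x : ℂ)) (by simp)
    (fun w => continuous_const.sub
      (Complex.continuous_ofReal.comp (continuous_productCutoff hφ w)))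
    (hasPartialDerivAt_one_sub_productCutoff hφ)

theorem iterPartial_one_sub_productCutoff (hφ : ∀ k s, HasDerivAt (φ k) (φ (k + 1) s) s) {R : ℝ}
    (w : List (Fin d)) :
    iterPartial w (fun x : Rd d => 1 - (productCutoff φ R [] x : ℂ)) =
      fun x => (if w = [] then 1 else 0) - (productCutoff φ R w x : ℂ) :=
  iterPartial_eq_of_family
    (fun w x => (if w = [] then 1 else 0) - (productCutoff φ R w x : ℂ)) (by simp)
    (hasPartialDerivAt_one_sub_productCutoff hφ) w

theorem WeightSequence.prod_M_le (W : WeightSequence) {ι : Type*} (s : Finset ι) (c : ι → ℕ) :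
    ∏ i ∈ s, W.M (c i) ≤ W.M (∑ i ∈ s, c i) := by
  classical
  induction s using Finset.induction_on with
  | empty => simp [W.zero]
  | insert i s hi ih =>
    rw [Finset.prod_insert hi, Finset.sum_insert hi]
    exact (mul_le_mul_of_nonneg_left ih (W.pos _).le).trans (W.M_mul_le _ _)

theorem abs_productCutoff_le (W : WeightSequence) {h : ℝ} (hh : 0 < h)
    (hφ : ∀ k s, |φ k s| ≤ h ^ k * W.M k) {R : ℝ} (hR : 1 ≤ R) (w : List (Fin d)) (x : Rd d) :
    |productCutoff φ R w x| ≤ h ^ w.length * W.M w.length := by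
  rw [productCutoff, Finset.abs_prod]
  calc ∏ i, |R⁻¹ ^ w.count i * φ (w.count i) (x i / R)|
      ≤ ∏ i, (h ^ w.count i * W.M (w.count i)) := by
        refine Finset.prod_le_prod (fun _ _ => abs_nonneg _) fun i _ => ?_
        rw [abs_mul, abs_of_nonneg (by positivity : (0 : ℝ) ≤ R⁻¹ ^ w.count i)]
        exact (mul_le_of_le_one_left (abs_nonneg _)
          (pow_le_one₀ (by positivity) (inv_le_one_of_one_le₀ hR))).trans (hφ _ _)
    _ ≤ h ^ w.length * W.M w.length := by
        rw [Finset.prod_mul_distrib, Finset.prod_pow_eq_pow_sum, ← len_count w]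
        exact mul_le_mul_of_nonneg_left (W.prod_M_le _ _) (by positivity)

end ProductCutoff

section QT

variable {W : WeightSequence} {d : ℕ} {E : Type*} [AddCommGroup E] [Module ℂ E]
  [TopologicalSpace E] [T2Space E] [IsTopologicalAddGroup E] [ContinuousSMul ℂ E]

theorem le_qt (q : ContSeminorm E) (t : RSeq) (f : DLinf W d E) (α : Fin d → ℕ) (x : Rd d) :
    q.1 (mDeriv α f.toFun x) ≤ qt W d E (q, t) f * weight W t α := by
  rw [← div_le_iff₀ (weight_pos W t α)]
  exact le_ciSup (f.bddAbove q t) (α, x)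

theorem qt_le (q : ContSeminorm E) (t : RSeq) {f : DLinf W d E} {C : ℝ}
    (h : ∀ α x, q.1 (mDeriv α f.toFun x) ≤ C * weight W t α) : qt W d E (q, t) f ≤ C :=
  ciSup_le fun p => (div_le_iff₀ (weight_pos W t p.1)).2 (h p.1 p.2)

/-- The modulus, as a continuous seminorm on `ℂ`. -/
def absSeminorm : ContSeminorm ℂ := ⟨normSeminorm ℂ ℂ, continuous_norm⟩

theorem ContSeminorm.apply_complex (q : ContSeminorm ℂ) (z : ℂ) : q.1 z = ‖z‖ * q.1 1 := by
  conv_lhs => rw [← mul_one z, ← smul_eq_mul, map_smul_eq_mul]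

theorem weight_eq (t : RSeq) (w : List (Fin d)) :
    weight W t (fun i => w.count i) = t.T w.length * W.M w.length := by
  rw [weight, len_count]

theorem norm_iterPartial_le (t : RSeq) (f : DLinf W d ℂ) (w : List (Fin d)) (x : Rd d) :
    ‖iterPartial w f.toFun x‖ ≤
      qt W d ℂ (absSeminorm, t) f * (t.T w.length * W.M w.length) := by
  rw [norm_iterPartial_eq f.isSmooth, ← weight_eq]
  exact le_qt absSeminorm t f _ x

/-- Membership in the scalar space, from estimates of the iterated partial derivatives. -/
theorem exists_DLinf {g : Rd d → ℂ} (hg : IsSmooth g) {h C : ℝ} (hh : 0 < h)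
    (hb : ∀ w x, ‖iterPartial w g x‖ ≤ C * h ^ w.length * W.M w.length) :
    ∃ f : DLinf W d ℂ, f.toFun = g := by
  refine ⟨⟨g, hg, fun q t => ?_⟩, rfl⟩
  obtain ⟨C', hC', hle⟩ := t.exists_pow_le hh
  have hC : 0 ≤ C := by
    have := (norm_nonneg _).trans (hb [] 0)
    simpa [W.zero] using this
  refine ⟨C * C' * q.1 1, fun α x => ?_⟩
  rw [div_le_iff₀ (weight_pos W t α), q.apply_complex, norm_mDeriv_eq, mul_right_comm]
  refine mul_le_mul_of_nonneg_right ((hb _ x).trans ?_) (apply_nonneg _ _)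
  rw [length_indexList, weight, mul_assoc C, mul_assoc C, ← mul_assoc C']
  exact mul_le_mul_of_nonneg_left (mul_le_mul_of_nonneg_right (hle _) (W.pos _).le) hC

/-- The elements of the scalar space satisfy Roumieu bounds, by Komatsu's lemma. -/
theorem DLinf.exists_roumieu_bound (f : DLinf W d ℂ) : ∃ h C : ℝ, 0 < h ∧ 0 < C ∧
    ∀ w x, ‖iterPartial w f.toFun x‖ ≤ C * h ^ w.length * W.M w.length := by
  have hb : ∀ (t : RSeq) (k : ℕ) (p : {w : List (Fin d) // w.length = k} × Rd d),
      ‖iterPartial p.1.1 f.toFun p.2‖ / W.M k ≤ qt W d ℂ (absSeminorm, t) f * t.T k := by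
    rintro t k ⟨⟨w, rfl⟩, x⟩
    rw [div_le_iff₀ (W.pos _), mul_assoc]
    exact norm_iterPartial_le t f w x
  obtain ⟨h, C, hh, hC, hle⟩ := exists_geometric_bound
    (a := fun k => ⨆ p : {w : List (Fin d) // w.length = k} × Rd d,
      ‖iterPartial p.1.1 f.toFun p.2‖ / W.M k) fun t =>
    ⟨qt W d ℂ (absSeminorm, t) f, fun k =>
      Real.iSup_le (hb t k) (mul_nonneg (apply_nonneg _ _) (t.T_pos k).le)⟩
  refine ⟨h, C, hh, hC, fun w x => ?_⟩
  rw [← div_le_iff₀ (W.pos _)]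
  have t : RSeq := Classical.arbitrary _
  refine le_trans ?_ (hle w.length)
  exact le_ciSup (f := fun p : {v : List (Fin d) // v.length = w.length} × Rd d =>
    ‖iterPartial p.1.1 f.toFun p.2‖ / W.M w.length)
    ⟨_, by rintro _ ⟨p, rfl⟩; exact hb t _ p⟩ ⟨⟨w, rfl⟩, x⟩

end QT

section Density

variable {W : WeightSequence} {d : ℕ}

theorem mem_BdotVec_of_mem_Bdot {f : DLinf W d ℂ} (hf : f ∈ Bdot W d) :
    f ∈ BdotVec W d ℂ := by
  intro ε hε q t
  have hU : {g | qt W d ℂ (q, t) (g - f) < ε} ∈ 𝓝 f := by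
    have h1 : Tendsto (fun g : DLinf W d ℂ => g) (𝓝 f) (𝓝 f) := tendsto_id
    exact ((withSeminorms_qt W d ℂ).tendsto_nhds _ f).1 h1 (q, t) ε hε
  obtain ⟨g, hg, hg'⟩ := mem_closure_iff_nhds.1
    (show f ∈ closure (testFunctions W d : Set _) from hf) _ hU
  refine ⟨tsupport g.toFun, hg'.1.isCompact, fun α x hx => ?_⟩
  have h0 : mDeriv α g.toFun x = 0 := by
    rw [mDeriv, iterPartial_eq_zero_of_isOpen (isClosed_tsupport g.toFun).isOpen_compl
      (fun y hy => image_eq_zero_of_notMem_tsupport hy) _ x hx, smul_zero]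
  have h1 : mDeriv α (g - f).toFun x = -mDeriv α f.toFun x := by
    have : g - f = g + (-1 : ℂ) • f := by rw [neg_one_smul, sub_eq_add_neg]
    rw [this, DLinf.toFun_add, mDeriv_add g.isSmooth (((-1 : ℂ) • f).isSmooth), h0,
      DLinf.toFun_smul, mDeriv_smul f.isSmooth]
    simp
  rw [div_le_iff₀ (weight_pos W t α), ← map_neg_eq_map q.1, ← h1]
  exact (le_qt q t _ α x).trans (mul_le_mul_of_nonneg_right (le_of_lt hg) (weight_pos W t α).le)

/-- A scalar function which vanishes at infinity is the limit of its products with the cutoffs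
`x ↦ ∏ i, φ (x i / R)`. -/
theorem mem_Bdot_of_mem_BdotVec {f : DLinf W d ℂ} (hf : f ∈ BdotVec W d ℂ) : f ∈ Bdot W d := by
  obtain ⟨φ, h, hh, hφ, hφb, hφ1, hφ0⟩ := W.exists_cutoff
  obtain ⟨r, C, hr, hC, hfb⟩ := f.exists_roumieu_bound
  have hR : ∀ n : ℕ, (1 : ℝ) ≤ n + 1 := fun n => by linarith [Nat.cast_nonneg (α := ℝ) n]
  -- the products with the cutoffs are test functions
  have hu : ∀ n : ℕ, ∃ u ∈ testFunctions W d, u.toFun =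
      fun x => f.toFun x * (productCutoff φ (n + 1) [] x : ℂ) := by
    intro n
    set χ : Rd d → ℂ := fun x => (productCutoff φ (n + 1) [] x : ℂ) with hχ
    have hχs : IsSmooth χ := isSmooth_productCutoff hφ
    have hle : ∀ w x, ‖iterPartial w (fun x => f.toFun x * χ x) x‖ ≤
        (C * 1) * (2 * max r h) ^ w.length * W.M w.length := by
      intro w x
      refine (norm_iterPartial_mul_le f.isSmooth hχs (N := fun k => max r h ^ k * W.M k)
        (fun k => mul_nonneg (by positivity) (W.pos k).le) (fun p q => ?_) (A := C) (B := 1)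
        (fun w => ?_) (fun w => ?_) hC.le zero_le_one w).trans (le_of_eq ?_)
      · rw [pow_add, mul_mul_mul_comm]
        exact mul_le_mul_of_nonneg_left (W.M_mul_le p q) (by positivity)
      · refine (hfb w x).trans ?_
        rw [mul_assoc]
        refine mul_le_mul_of_nonneg_left (mul_le_mul_of_nonneg_right
          (pow_le_pow_left₀ hr.le (le_max_left _ _) _) (W.pos _).le) hC.le
      · rw [hχ, iterPartial_productCutoff hφ, one_mul, Complex.norm_real, Real.norm_eq_abs]
        exact (abs_productCutoff_le W hh hφb (hR n) w x).trans (mul_le_mul_of_nonneg_right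
          (pow_le_pow_left₀ hh.le (le_max_right _ _) _) (W.pos _).le)
      · rw [mul_pow]
        ring
    have hpos : 0 < max r h := lt_max_of_lt_left hr
    obtain ⟨u, hu⟩ := exists_DLinf (W := W) (f.isSmooth.mul hχs) (by positivity) hle
    refine ⟨u, ⟨?_, 2 * max r h, C * 1, by positivity, by positivity, fun α x => ?_⟩, hu⟩
    · rw [hu]
      refine HasCompactSupport.mul_left (HasCompactSupport.intro
        (isCompact_closedBall (0 : Rd d) (∑ i : Fin d, 4 * ((n : ℝ) + 1))) fun x hx => ?_)
      -- outside of a large ball some coordinate is large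
      have : ∃ i, 4 ≤ |x i / (n + 1)| := by
        by_contra! hcon
        refine hx ?_
        rw [mem_closedBall_zero_iff]
        rw [eq_sum_single x]
        refine (norm_sum_le _ _).trans (Finset.sum_le_sum fun i _ => ?_)
        have := hcon i
        rw [abs_div, abs_of_pos (by positivity : (0 : ℝ) < n + 1), div_lt_iff₀ (by positivity)]
          at this
        simpa [norm_smul] using this.le
      obtain ⟨i, hi⟩ := this
      rw [hχ]
      simp only [Complex.ofReal_eq_zero]
      exact Finset.prod_eq_zero (Finset.mem_univ i) (by simp [hφ0 _ hi])
    · rw [norm_mDeriv_eq, hu, ← length_indexList α]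
      exact hle _ x
  choose u hu hu' using hu
  refine mem_closure_of_tendsto (b := atTop) (f := u) ?_ (Eventually.of_forall hu)
  rw [(withSeminorms_qt W d ℂ).tendsto_nhds]
  rintro ⟨q, t⟩ ε hε
  -- the factor `2 ^ |w|` in the Leibniz estimate is compensated by the use of `t / 2`
  set s : RSeq := t.divConst 2 two_pos with hs
  obtain ⟨B, hB, hBle⟩ := s.exists_pow_le hh
  obtain ⟨K, hK, hKle⟩ := hf (ε / (2 * (q.1 1 + 1) * (2 * B))) (by
    have := apply_nonneg q.1 1
    positivity) absSeminorm s
  obtain ⟨ρ, hρ⟩ := hK.isBounded.subset_ball (0 : Rd d)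
  filter_upwards [eventually_ge_atTop ⌈ρ⌉₊] with n hn
  set η : Rd d → ℂ := fun x => 1 - (productCutoff φ (n + 1) [] x : ℂ) with hη
  have hηs : IsSmooth η := isSmooth_one_sub_productCutoff hφ
  have hsub : (f - u n).toFun = fun x => f.toFun x * η x := by
    have : (f - u n).toFun = f.toFun - (u n).toFun := rfl
    rw [this, hu']
    funext x
    simp only [Pi.sub_apply, hη]
    ring
  rw [← map_neg_eq_map, neg_sub]
  have hq := apply_nonneg q.1 1
  refine lt_of_le_of_lt (qt_le q t (C := ε / 2) fun α x => ?_) (half_lt_self hε)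
  rw [q.apply_complex, norm_mDeriv_eq, hsub]
  by_cases hx : x ∈ K
  · have hball : ∀ y ∈ Metric.ball (0 : Rd d) (n + 1), f.toFun y * η y = 0 := by
      intro y hy
      rw [mem_ball_zero_iff] at hy
      have : productCutoff φ ((n : ℝ) + 1) [] y = 1 := by
        refine Finset.prod_eq_one fun i _ => ?_
        rw [List.count_nil, pow_zero, one_mul]
        refine hφ1 _ ?_
        rw [abs_div, abs_of_pos (by positivity : (0 : ℝ) < n + 1), div_le_one (by positivity)]
        exact (PiLp.norm_apply_le y i).trans hy.le
      simp [hη, this]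
    rw [iterPartial_eq_zero_of_isOpen Metric.isOpen_ball hball _ x, norm_zero, zero_mul]
    · exact mul_nonneg (half_pos hε).le (weight_pos W t α).le
    · refine Metric.ball_subset_ball ?_ (hρ hx)
      exact (Nat.ceil_le.1 hn).trans (by linarith)
  · have := norm_iterPartial_mul_le f.isSmooth hηs (N := fun k => s.T k * W.M k)
      (fun k => (mul_pos (s.T_pos k) (W.pos k)).le) (fun k l => ?_) (x := x)
      (A := ε / (2 * (q.1 1 + 1) * (2 * B))) (B := 2 * B) (fun w => ?_) (fun w => ?_)
      (by positivity) (by positivity) (indexList α)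
    · rw [length_indexList, hs, RSeq.T_divConst] at this
      calc _ ≤ _ := mul_le_mul_of_nonneg_right this hq
        _ = ε / 2 * (q.1 1 / (q.1 1 + 1)) * weight W t α := by
            rw [weight]
            field_simp
        _ ≤ ε / 2 * 1 * weight W t α := by
            refine mul_le_mul_of_nonneg_right (mul_le_mul_of_nonneg_left ?_ (half_pos hε).le)
              (weight_pos W t α).le
            rw [div_le_one (by positivity)]
            linarith
        _ = _ := by rw [mul_one]
    · rw [mul_mul_mul_comm]
      exact mul_le_mul (s.T_mul_le k l) (W.M_mul_le k l) (mul_pos (W.pos _) (W.pos _)).le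
        (s.T_pos _).le
    · rw [norm_iterPartial_eq f.isSmooth, ← weight_eq, ← div_le_iff₀ (weight_pos W s _)]
      exact hKle _ x hx
    · rw [hη, iterPartial_one_sub_productCutoff hφ]
      have h1 := abs_productCutoff_le W hh hφb (hR n) w x
      have h2 : ‖(if w = [] then 1 else 0 : ℂ)‖ ≤ h ^ w.length * W.M w.length := by
        split_ifs with hw
        · simp [hw, W.zero]
        · rw [norm_zero]
          exact mul_nonneg (by positivity) (W.pos _).le
      refine (norm_sub_le _ _).trans ?_
      rw [Complex.norm_real, Real.norm_eq_abs]
      have h3 := mul_le_mul_of_nonneg_right (hBle w.length) (W.pos w.length).le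
      linarith

end Density

/-! ### From vector-valued functions to hypocontinuous functionals -/

section ScalarTopology

variable {W : WeightSequence} {d : ℕ}

/-- The minimum of two sequences in `𝔑`. -/
def RSeq.min (s t : RSeq) : RSeq where
  t j := Min.min (s.t j) (t.t j)
  pos j := lt_min (s.pos j) (t.pos j)
  mono _ _ h := min_le_min (s.mono h) (t.mono h)
  tendsto := tendsto_atTop.2 fun b => by
    filter_upwards [s.tendsto.eventually_ge_atTop b, t.tendsto.eventually_ge_atTop b] with j h h'
    exact le_min h h'

theorem qt_abs_le_of_le {s t : RSeq} (h : ∀ j, s.t j ≤ t.t j) (f : DLinf W d ℂ) :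
    qt W d ℂ (absSeminorm, t) f ≤ qt W d ℂ (absSeminorm, s) f :=
  qt_le _ _ fun α x => (le_qt absSeminorm s f α x).trans
    (mul_le_mul_of_nonneg_left (mul_le_mul_of_nonneg_right
      (Finset.prod_le_prod (fun j _ => (s.pos j).le) fun j _ => h j) (W.pos _).le)
      (apply_nonneg _ _))

theorem qt_le_abs (q : ContSeminorm ℂ) (t : RSeq) (f : DLinf W d ℂ) :
    qt W d ℂ (q, t) f ≤ q.1 1 * qt W d ℂ (absSeminorm, t) f :=
  qt_le _ _ fun α x => by
    rw [q.apply_complex, mul_comm, mul_assoc]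
    exact mul_le_mul_of_nonneg_left (le_qt absSeminorm t f α x) (apply_nonneg _ _)

theorem finset_sup_qt_le (s : Finset (ContSeminorm ℂ × RSeq)) :
    ∃ (t : RSeq) (C : ℝ), 0 ≤ C ∧ ∀ f, s.sup (qt W d ℂ) f ≤ C * qt W d ℂ (absSeminorm, t) f := by
  classical
  induction s using Finset.induction_on with
  | empty =>
    exact ⟨Classical.arbitrary _, 0, le_rfl, fun f => by simp⟩
  | insert a s _ ih =>
    obtain ⟨t, C, hC, h⟩ := ih
    refine ⟨t.min a.2, C + a.1.1 1, add_nonneg hC (apply_nonneg _ _), fun f => ?_⟩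
    rw [Finset.sup_insert, Seminorm.sup_apply, add_mul]
    have h1 := qt_abs_le_of_le (W := W) (s := t.min a.2) (t := t) (fun j => min_le_left _ _) f
    have h2 := qt_abs_le_of_le (W := W) (s := t.min a.2) (t := a.2) (fun j => min_le_right _ _) f
    have h3 := mul_le_mul_of_nonneg_left h1 hC
    have h4 := mul_le_mul_of_nonneg_left h2 (apply_nonneg a.1.1 1)
    have h5 : 0 ≤ C * qt W d ℂ (absSeminorm, t.min a.2) f := mul_nonneg hC (apply_nonneg _ _)
    have h6 : 0 ≤ a.1.1 1 * qt W d ℂ (absSeminorm, t.min a.2) f :=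
      mul_nonneg (apply_nonneg _ _) (apply_nonneg _ _)
    refine max_le ?_ ?_
    · linarith [qt_le_abs a.1 a.2 f]
    · linarith [h f]

/-- The seminorms `‖·‖_{(t_j)}` on the scalar space. -/
def bdotSeminorm (W : WeightSequence) (d : ℕ) (t : RSeq) : Seminorm ℂ (Bdot W d) :=
  (qt W d ℂ (absSeminorm, t)).comp (Bdot W d).subtype

theorem continuous_bdotSeminorm (t : RSeq) : Continuous (bdotSeminorm W d t) :=
  ((withSeminorms_qt W d ℂ).continuous_seminorm _).comp continuous_subtype_val

theorem withSeminorms_bdot :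
    WithSeminorms fun i => (qt W d ℂ i).comp (Bdot W d).subtype :=
  IsInducing.subtypeVal.withSeminorms (withSeminorms_qt W d ℂ)

instance : LocallyConvexSpace ℝ (Bdot W d) := (withSeminorms_bdot).toLocallyConvexSpace

theorem exists_le_bdotSeminorm (p : ContSeminorm (Bdot W d)) :
    ∃ (t : RSeq) (C : ℝ), 0 ≤ C ∧ ∀ f, p.1 f ≤ C * bdotSeminorm W d t f := by
  obtain ⟨s, c, -, hc⟩ := Seminorm.bound_of_continuous withSeminorms_bdot p.1 p.2
  obtain ⟨t, C, hC, h⟩ := finset_sup_qt_le (W := W) (d := d) s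
  refine ⟨t, c * C, mul_nonneg c.2 hC, fun f => (hc f).trans ?_⟩
  rw [mul_assoc]
  refine mul_le_mul_of_nonneg_left ?_ c.2
  refine le_trans (le_of_eq ?_) (h f)
  exact DFunLike.congr_fun ((qt W d ℂ).finset_sup_comp s (Bdot W d).subtype).symm f

end ScalarTopology

section Forward

set_option linter.unusedSectionVars false

variable {W : WeightSequence} {d : ℕ} {E : Type*} [AddCommGroup E] [Module ℂ E]
  [TopologicalSpace E] [T2Space E] [IsTopologicalAddGroup E] [ContinuousSMul ℂ E]

/-- The seminorm `|e|` of a continuous linear functional `e`. -/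
def dualSeminorm (e : E →L[ℂ] ℂ) : ContSeminorm E :=
  ⟨(normSeminorm ℂ ℂ).comp e.toLinearMap, e.continuous.norm⟩

/-- The composition of a vector-valued function with a functional. -/
def compDLinf (φ : DLinf W d E) (e : E →L[ℂ] ℂ) : DLinf W d ℂ :=
  ⟨fun x => e (φ.toFun x), φ.isSmooth.clm_comp e, fun q t =>
    ⟨qt W d E (dualSeminorm e, t) φ * q.1 1, fun α x => by
      rw [div_le_iff₀ (weight_pos W t α), φ.isSmooth.mDeriv_clm_comp, q.apply_complex,
        mul_right_comm]
      exact mul_le_mul_of_nonneg_right (le_qt (dualSeminorm e) t φ α x) (apply_nonneg _ _)⟩⟩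

theorem mDeriv_compDLinf (φ : DLinf W d E) (e : E →L[ℂ] ℂ) (α : Fin d → ℕ) (x : Rd d) :
    mDeriv α (compDLinf φ e).toFun x = e (mDeriv α φ.toFun x) :=
  φ.isSmooth.mDeriv_clm_comp e α x

theorem compDLinf_mem (φ : BdotVec W d E) (e : E →L[ℂ] ℂ) : compDLinf φ.1 e ∈ Bdot W d := by
  refine mem_Bdot_of_mem_BdotVec fun ε hε q t => ?_
  have hq : 0 < q.1 1 + 1 := add_pos_of_nonneg_of_pos (apply_nonneg _ _) one_pos
  obtain ⟨K, hK, h⟩ := φ.2 (ε / (q.1 1 + 1)) (by positivity) (dualSeminorm e) t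
  refine ⟨K, hK, fun α x hx => ?_⟩
  have h1 := h α x hx
  rw [mDeriv_compDLinf, q.apply_complex, mul_div_right_comm]
  refine (mul_le_mul h1 (le_add_of_nonneg_right zero_le_one) (apply_nonneg _ _)
    (by positivity)).trans (le_of_eq ?_)
  field_simp

/-- The map `e ↦ e ∘ φ` from the dual of `E` to the scalar space. -/
def compBdot (φ : BdotVec W d E) : DualC E →ₗ[ℂ] Bdot W d where
  toFun e := ⟨compDLinf φ.1 e, compDLinf_mem φ e⟩
  map_add' _ _ := rfl
  map_smul' _ _ := rfl

theorem bdotSeminorm_compBdot_le (φ : BdotVec W d E) (e : DualC E) (t : RSeq) {C : ℝ}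
    (h : ∀ α x, ‖e (mDeriv α φ.1.toFun x)‖ ≤ C * weight W t α) :
    bdotSeminorm W d t (compBdot φ e) ≤ C :=
  qt_le absSeminorm t fun α x => by
    exact (congrArg norm (mDeriv_compDLinf φ.1 e α x)).le.trans (h α x)

/-- The weighted derivatives `D^α φ(x) / (T_α M_α)`. -/
def derivSet (φ : BdotVec W d E) (t : RSeq) : Set E :=
  range fun p : (Fin d → ℕ) × Rd d => ((weight W t p.1)⁻¹ : ℂ) • mDeriv p.1 φ.1.toFun p.2

theorem seminorm_weight_inv_smul (q : Seminorm ℂ E) (t : RSeq) (α : Fin d → ℕ) (y : E) :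
    q (((weight W t α)⁻¹ : ℂ) • y) = q y / weight W t α := by
  rw [map_smul_eq_mul, norm_inv, Complex.norm_real,
    Real.norm_of_nonneg (weight_pos W t α).le, inv_mul_eq_div]

theorem IsSmooth.continuous_mDeriv {f : Rd d → E} (hf : IsSmooth f) (α : Fin d → ℕ) :
    Continuous (mDeriv α f) := (hf _).1.const_smul _

/-- The weighted derivatives form a precompact set: those of high order are small, because of the
bounds with respect to `t / 2`, and each of the others vanishes at infinity. -/
theorem hasFiniteNets_derivSet (φ : BdotVec W d E) (t : RSeq) :
    HasFiniteNets (derivSet φ t) := by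
  intro q ε hε
  set s := t.divConst 2 two_pos with hs
  set C := qt W d E (q, s) φ.1 with hC
  obtain ⟨n, hn⟩ := pow_unbounded_of_one_lt (C / ε) one_lt_two
  obtain ⟨K, hK, hKle⟩ := φ.2 ε hε q t
  have hfin : {α : Fin d → ℕ | len α < n}.Finite := by
    refine (Set.finite_Iic (fun _ : Fin d => n)).subset fun α hα i => ?_
    exact (Finset.single_le_sum (fun i _ => Nat.zero_le _) (Finset.mem_univ i)).trans
      (le_of_lt hα)
  have hcomp : IsCompact (⋃ α ∈ {α : Fin d → ℕ | len α < n},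
      (fun x => ((weight W t α)⁻¹ : ℂ) • mDeriv α φ.1.toFun x) '' K) :=
    hfin.isCompact_biUnion fun α _ =>
      hK.image ((φ.1.isSmooth.continuous_mDeriv α).const_smul ((weight W t α)⁻¹ : ℂ))
  obtain ⟨u, -, hu⟩ := hcomp.elim_nhds_subcover (fun y => {x | q.1 (x - y) < ε}) fun y _ => by
    have : Continuous fun x => q.1 (x - y) := q.2.comp (continuous_id.sub continuous_const)
    exact (isOpen_lt this continuous_const).mem_nhds (by simpa using hε)
  refine ⟨insert 0 u, u.finite_toSet.insert 0, ?_⟩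
  rintro _ ⟨⟨α, x⟩, rfl⟩
  by_cases hα : len α < n
  · by_cases hx : x ∈ K
    · obtain ⟨y, hy, hxy⟩ := mem_iUnion₂.1 (hu (mem_iUnion₂.2 ⟨α, hα, x, hx, rfl⟩))
      exact ⟨y, mem_insert_of_mem _ hy, le_of_lt hxy⟩
    · refine ⟨0, mem_insert _ _, ?_⟩
      rw [sub_zero, seminorm_weight_inv_smul]
      exact hKle α x hx
  · refine ⟨0, mem_insert _ _, ?_⟩
    rw [sub_zero, seminorm_weight_inv_smul, div_le_iff₀ (weight_pos W t α)]
    refine (le_qt q s φ.1 α x).trans ?_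
    rw [← hC, weight, hs, RSeq.T_divConst, weight, div_mul_eq_mul_div, mul_div_assoc',
      div_le_iff₀ (by positivity)]
    have h1 : C ≤ ε * 2 ^ len α := by
      rw [div_lt_iff₀ hε] at hn
      have : (2 : ℝ) ^ n ≤ 2 ^ len α := pow_le_pow_right₀ one_le_two (not_lt.1 hα)
      nlinarith
    calc C * (t.T (len α) * W.M (len α)) ≤ ε * 2 ^ len α * (t.T (len α) * W.M (len α)) :=
          mul_le_mul_of_nonneg_right h1 (mul_pos (t.T_pos _) (W.pos _)).le
      _ = _ := by ring

theorem norm_apply_mDeriv_le (φ : BdotVec W d E) (t : RSeq) {C : ℝ} {e : DualC E}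
    (h : ∀ y ∈ derivSet φ t, ‖e y‖ ≤ C) (α : Fin d → ℕ) (x : Rd d) :
    ‖e (mDeriv α φ.1.toFun x)‖ ≤ C * weight W t α := by
  have := h _ ⟨(α, x), rfl⟩
  rwa [map_smul, norm_smul, norm_inv, Complex.norm_real,
    Real.norm_of_nonneg (weight_pos W t α).le, inv_mul_le_iff₀ (weight_pos W t α), mul_comm] at this

/-- The compositions `e ∘ φ` with the functionals `|e| ≤ q` form a convex circled compact subset
of the scalar space: they are the image of a weak-* compact set under a continuous map. -/
theorem isCompact_compBdot_image (φ : BdotVec W d E) (q : ContSeminorm E) :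
    IsCompact (compBdot φ '' {e | ∀ x, ‖e x‖ ≤ q.1 x}) ∧
      Convex ℝ (compBdot φ '' {e | ∀ x, ‖e x‖ ≤ q.1 x}) ∧
      Balanced ℂ (compBdot φ '' {e | ∀ x, ‖e x‖ ≤ q.1 x}) := by
  refine ⟨?_, ?_, ?_⟩
  · have hcont : ∀ g : seminormPolar q.1, ∃ e : DualC E, ⇑e = g.1 := fun g => by
      let l : E →ₗ[ℂ] ℂ := { toFun := g.1, map_add' := g.2.2.1, map_smul' := g.2.2.2 }
      refine ⟨(⟨l, ?_⟩ : E →L[ℂ] ℂ), rfl⟩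
      refine continuous_of_continuousAt_zero l ?_
      rw [ContinuousAt, map_zero]
      refine squeeze_zero_norm (a := fun x => q.1 x) g.2.1 ?_
      simpa using q.2.tendsto 0
    choose Ψ hΨ using hcont
    have himage : compBdot φ '' {e | ∀ x, ‖e x‖ ≤ q.1 x} = range fun g => compBdot φ (Ψ g) := by
      apply Subset.antisymm
      · rintro _ ⟨e, he, rfl⟩
        refine ⟨⟨e, he, map_add e, fun c x => map_smul e c x⟩, ?_⟩
        exact congrArg (compBdot φ) (DFunLike.coe_injective (hΨ _))
      · rintro _ ⟨g, rfl⟩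
        exact ⟨Ψ g, fun x => by rw [hΨ]; exact g.2.1 x, rfl⟩
    rw [himage]
    have : CompactSpace (seminormPolar q.1) :=
      isCompact_iff_compactSpace.1 (isCompact_seminormPolar q.1)
    refine isCompact_range (continuous_iff_continuousAt.2 fun g₀ => ?_)
    rw [ContinuousAt, withSeminorms_bdot.tendsto_nhds]
    rintro ⟨p, t⟩ ε hε
    have hp : 0 < p.1 1 + 1 := add_pos_of_nonneg_of_pos (apply_nonneg _ _) one_pos
    set δ := ε / (4 * (p.1 1 + 1)) with hδ
    have hδ0 : 0 < δ := by positivity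
    obtain ⟨u, hu, hnet⟩ := hasFiniteNets_derivSet φ t q δ hδ0
    have hev : ∀ᶠ g in 𝓝 g₀, ∀ y ∈ u, ‖g.1 y - g₀.1 y‖ < δ := by
      refine (eventually_all_finite hu).2 fun y _ => ?_
      have hc : Continuous fun g : seminormPolar q.1 => ‖g.1 y - g₀.1 y‖ :=
        (((continuous_apply y).comp continuous_subtype_val).sub continuous_const).norm
      exact hc.continuousAt.eventually_lt continuousAt_const (by simpa using hδ0)
    filter_upwards [hev] with g hg
    have hle : ∀ y ∈ derivSet φ t, ‖(Ψ g - Ψ g₀) y‖ ≤ 3 * δ := by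
      intro y hy
      obtain ⟨z, hz, hyz⟩ := hnet y hy
      have e1 : (Ψ g - Ψ g₀) y = Ψ g (y - z) - Ψ g₀ (y - z) + (g.1 z - g₀.1 z) := by
        have : (Ψ g - Ψ g₀) y = Ψ g y - Ψ g₀ y := rfl
        rw [this, map_sub, map_sub, ← hΨ, ← hΨ]
        ring
      rw [e1]
      have h1 : ‖Ψ g (y - z)‖ ≤ δ := by rw [hΨ]; exact (g.2.1 _).trans hyz
      have h2 : ‖Ψ g₀ (y - z)‖ ≤ δ := by rw [hΨ]; exact (g₀.2.1 _).trans hyz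
      linarith [norm_add_le (Ψ g (y - z) - Ψ g₀ (y - z)) (g.1 z - g₀.1 z),
        norm_sub_le (Ψ g (y - z)) (Ψ g₀ (y - z)), hg z hz]
    have h1 := bdotSeminorm_compBdot_le φ (Ψ g - Ψ g₀) t (norm_apply_mDeriv_le φ t hle)
    rw [map_sub] at h1
    have h2 := qt_le_abs p t (compBdot φ (Ψ g) - compBdot φ (Ψ g₀)).1
    have h3 := mul_le_mul_of_nonneg_left h1 (apply_nonneg p.1 1)
    refine lt_of_le_of_lt (h2.trans h3) ?_
    have h4 : p.1 1 * (3 * δ) ≤ (p.1 1 + 1) * (3 * δ) :=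
      mul_le_mul_of_nonneg_right (by linarith) (by positivity)
    have h5 : (p.1 1 + 1) * (3 * δ) = 3 / 4 * ε := by
      rw [hδ]
      field_simp
    linarith
  · rintro _ ⟨e, he, rfl⟩ _ ⟨e', he', rfl⟩ a b ha hb hab
    refine ⟨(a : ℂ) • e + (b : ℂ) • e', fun x => ?_, ?_⟩
    · have : ((a : ℂ) • e + (b : ℂ) • e') x = a * e x + b * e' x := rfl
      rw [this]
      refine (norm_add_le _ _).trans ?_
      rw [norm_mul, norm_mul, Complex.norm_real, Complex.norm_real, Real.norm_of_nonneg ha,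
        Real.norm_of_nonneg hb]
      have := add_le_add (mul_le_mul_of_nonneg_left (he x) ha)
        (mul_le_mul_of_nonneg_left (he' x) hb)
      rwa [← add_mul, hab, one_mul] at this
    · rw [map_add, map_smul, map_smul, Complex.coe_smul, Complex.coe_smul]
  · rw [balanced_iff_smul_mem]
    rintro c hc _ ⟨e, he, rfl⟩
    refine ⟨c • e, fun x => ?_, map_smul _ _ _⟩
    have : (c • e) x = c * e x := rfl
    rw [this, norm_mul]
    exact (mul_le_of_le_one_left (norm_nonneg _) hc).trans (he x)

end Forward

section ForwardMap

variable {W : WeightSequence} {d : ℕ} {E : Type*} [AddCommGroup E] [Module ℂ E]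
  [UniformSpace E] [IsUniformAddGroup E] [ContinuousSMul ℂ E] [LocallyConvexSpace ℝ E]
  [T2Space E] [CompleteSpace E]

/-- The bilinear functional `(u, e) ↦ u (e ∘ φ)`. -/
def pairing (φ : BdotVec W d E) : DualC (Bdot W d) →ₗ[ℂ] DualC E →ₗ[ℂ] ℂ :=
  LinearMap.mk₂ ℂ (fun u e => u (compBdot φ e)) (fun _ _ _ => rfl) (fun _ _ _ => rfl)
    (fun u e e' => by rw [map_add, map_add]) (fun c u e => by rw [map_smul, map_smul])

theorem isHypocontinuous_pairing (φ : BdotVec W d E) : IsHypocontinuous (pairing φ) := by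
  constructor
  · intro A hA U hU
    obtain ⟨p, hp⟩ := hA.exists_seminorm
    obtain ⟨t, C, hC, hpC⟩ := exists_le_bdotSeminorm p
    obtain ⟨K, hK, hSK⟩ := (hasFiniteNets_derivSet φ t).exists_compact
    obtain ⟨δ, hδ, hδU⟩ := Metric.mem_nhds_iff.1 hU
    refine ⟨_, DualC.setOf_le_mem_nhds hK (ε := δ / (C + 1)) (by positivity), fun u hu e he => ?_⟩
    refine hδU ?_
    rw [mem_ball_zero_iff]
    have h1 := bdotSeminorm_compBdot_le φ e t
      (norm_apply_mDeriv_le φ t fun y hy => he y (hSK hy))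
    have h2 := mul_le_mul_of_nonneg_left h1 hC
    refine ((hp u hu _).trans ((hpC _).trans h2)).trans_lt ?_
    rw [mul_div_assoc', div_lt_iff₀ (by positivity)]
    linarith
  · intro B hB U hU
    obtain ⟨q, hq⟩ := hB.exists_seminorm
    obtain ⟨δ, hδ, hδU⟩ := Metric.mem_nhds_iff.1 hU
    refine ⟨_, DualC.setOf_le_mem_nhds (isCompact_compBdot_image φ q) (half_pos hδ),
      fun e he u hu => hδU ?_⟩
    rw [mem_ball_zero_iff]
    exact (hu _ ⟨e, hq e he, rfl⟩).trans_lt (half_lt_self hδ)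

/-- The map `φ ↦ ((u, e) ↦ u (e ∘ φ))` into the `ε` tensor product. -/
def toEps : BdotVec W d E →ₗ[ℂ] Eps (Bdot W d) E where
  toFun φ := ⟨pairing φ, isHypocontinuous_pairing φ⟩
  map_add' φ ψ := by
    refine Subtype.ext (LinearMap.ext₂ fun u e => ?_)
    have : compBdot (φ + ψ) e = compBdot φ e + compBdot ψ e :=
      Subtype.ext (Subtype.ext (funext fun x => map_add e _ _))
    exact (congrArg u this).trans (map_add u _ _)
  map_smul' c φ := by
    refine Subtype.ext (LinearMap.ext₂ fun u e => ?_)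
    have : compBdot (c • φ) e = c • compBdot φ e :=
      Subtype.ext (Subtype.ext (funext fun x => map_smul e _ _))
    exact (congrArg u this).trans (map_smul u _ _)

theorem toEps_apply (φ : BdotVec W d E) (u : DualC (Bdot W d)) (e : DualC E) :
    (toEps φ).1 u e = u (compBdot φ e) := rfl

end ForwardMap

/-! ### From hypocontinuous functionals to vector-valued functions -/

section PointEvaluations

variable {W : WeightSequence} {d : ℕ}

/-- The functional `f ↦ ∂_w f(x)` on the scalar space. -/
def derivEval (w : List (Fin d)) (x : Rd d) : DualC (Bdot W d) :=
  let l : Bdot W d →ₗ[ℂ] ℂ :=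
    { toFun := fun f => iterPartial w f.1.toFun x
      map_add' := fun f g => congrFun (iterPartial_add f.1.isSmooth g.1.isSmooth w) x
      map_smul' := fun c f => congrFun (iterPartial_smul f.1.isSmooth c w) x }
  (⟨l, by
    let t : RSeq := Classical.arbitrary _
    refine continuous_of_continuousAt_zero l ?_
    rw [ContinuousAt, map_zero]
    refine squeeze_zero_norm
      (a := fun f => bdotSeminorm W d t f * (t.T w.length * W.M w.length))
      (fun f => norm_iterPartial_le t f.1 w x) ?_
    have := ((continuous_bdotSeminorm (W := W) (d := d) t).tendsto 0).mul_const
      (t.T w.length * W.M w.length)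
    rwa [map_zero, zero_mul] at this⟩ : Bdot W d →L[ℂ] ℂ)

theorem derivEval_apply (w : List (Fin d)) (x : Rd d) (f : Bdot W d) :
    derivEval w x f = iterPartial w f.1.toFun x := rfl

theorem norm_mDeriv_le_bdotSeminorm (t : RSeq) (f : Bdot W d) (α : Fin d → ℕ) (x : Rd d) :
    ‖mDeriv α f.1.toFun x‖ ≤ bdotSeminorm W d t f * weight W t α :=
  le_qt absSeminorm t f.1 α x

/-- The functions in a compact subset of the scalar space vanish at infinity uniformly. -/
theorem exists_compact_uniform_decay {K : Set (Bdot W d)} (hK : IsCompact K) (t : RSeq) {ε : ℝ}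
    (hε : 0 < ε) : ∃ L : Set (Rd d), IsCompact L ∧ ∀ f ∈ K, ∀ α, ∀ x ∉ L,
      ‖mDeriv α f.1.toFun x‖ ≤ ε * weight W t α := by
  obtain ⟨u, -, hu⟩ := hK.elim_nhds_subcover (fun g => {f | bdotSeminorm W d t (f - g) < ε / 2})
    fun g _ => by
      have : Continuous fun f => bdotSeminorm W d t (f - g) :=
        (continuous_bdotSeminorm t).comp (continuous_id.sub continuous_const)
      exact (isOpen_lt this continuous_const).mem_nhds (by simpa using hε)
  choose L hL hLle using fun g : Bdot W d =>
    mem_BdotVec_of_mem_Bdot g.2 (ε / 2) (half_pos hε) absSeminorm t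
  refine ⟨⋃ g ∈ u, L g, u.finite_toSet.isCompact_biUnion fun g _ => hL g, fun f hf α x hx => ?_⟩
  obtain ⟨g, hg, hfg⟩ := mem_iUnion₂.1 (hu hf)
  have hxg : x ∉ L g := fun h => hx (mem_iUnion₂.2 ⟨g, hg, h⟩)
  have h1 : ‖mDeriv α g.1.toFun x‖ ≤ ε / 2 * weight W t α :=
    (div_le_iff₀ (weight_pos W t α)).1 (hLle g α x hxg)
  have h2 := norm_mDeriv_le_bdotSeminorm t (f - g) α x
  have h3 : mDeriv α f.1.toFun x = mDeriv α (f - g).1.toFun x + mDeriv α g.1.toFun x := by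
    rw [← mDeriv_add (f - g).1.isSmooth g.1.isSmooth]
    congr 1
    rw [← DLinf.toFun_add]
    congr 1
    exact (sub_add_cancel f.1 g.1).symm
  rw [h3]
  refine (norm_add_le _ _).trans ?_
  have h4 := mul_le_mul_of_nonneg_right (le_of_lt hfg) (weight_pos W t α).le
  linarith

end PointEvaluations

section Singleton

variable {G : Type*} [AddCommGroup G] [Module ℂ G] [TopologicalSpace G]

theorem equicontSet_singleton [IsTopologicalAddGroup G] [ContinuousSMul ℂ G] (u : DualC G) :
    EquicontSet {u} :=
  equicontSet_of_seminorm (G := G)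
    ⟨(normSeminorm ℂ ℂ).comp (u : G →L[ℂ] ℂ).toLinearMap, (u : G →L[ℂ] ℂ).continuous.norm⟩
    fun v hv x => by
      rw [mem_singleton_iff.1 hv]
      exact le_rfl

end Singleton

section Represent

variable {F G : Type*} [AddCommGroup F] [Module ℂ F] [TopologicalSpace F]
  [IsTopologicalAddGroup F] [ContinuousSMul ℂ F]
  [AddCommGroup G] [Module ℂ G] [TopologicalSpace G] [IsTopologicalAddGroup G]
  [ContinuousSMul ℂ G] {b : DualC F →ₗ[ℂ] DualC G →ₗ[ℂ] ℂ}

theorem IsHypocontinuous.exists_right_eval (hb : IsHypocontinuous b) (u : DualC F) :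
    ∃ y : G, ∀ e, b u e = e y := by
  obtain ⟨V, hV, h⟩ := hb.left {u} (equicontSet_singleton u) _
    (Metric.closedBall_mem_nhds (0 : ℂ) one_pos)
  exact DualC.exists_eval_eq (b u) hV fun e he => by simpa using h u rfl e he

theorem IsHypocontinuous.exists_left_eval (hb : IsHypocontinuous b) (e : DualC G) :
    ∃ f : F, ∀ u, b u e = u f := by
  obtain ⟨V, hV, h⟩ := hb.right {e} (equicontSet_singleton e) _
    (Metric.closedBall_mem_nhds (0 : ℂ) one_pos)
  exact DualC.exists_eval_eq (b.flip e) hV fun u hu => by simpa using h e rfl u hu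

/-- A hypocontinuous functional is bounded on products of equicontinuous sets. -/
theorem IsHypocontinuous.exists_bound (hb : IsHypocontinuous b) (p : ContSeminorm F)
    (q : ContSeminorm G) : ∃ C : ℝ, ∀ u : DualC F, (∀ x, ‖u x‖ ≤ p.1 x) →
      ∀ e : DualC G, (∀ x, ‖e x‖ ≤ q.1 x) → ‖b u e‖ ≤ C := by
  obtain ⟨V, hV, h⟩ := hb.left {u | ∀ x, ‖u x‖ ≤ p.1 x} (equicontSet_of_seminorm p fun _ h => h) _
    (Metric.closedBall_mem_nhds (0 : ℂ) one_pos)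
  obtain ⟨K, ⟨hK, -, -⟩, -, ε, hε, hKV⟩ := DualC.exists_compact_of_mem_nhds hV
  obtain ⟨R, hR⟩ := hK.exists_bound_of_continuousOn q.2.continuousOn
  have hR0 : 0 < |R| + 1 := by positivity
  refine ⟨(|R| + 1) / ε, fun u hu e he => ?_⟩
  have h1 := h u hu (((ε / (|R| + 1) : ℝ) : ℂ) • e) (hKV _ fun x hx => by
    have h2 : (((ε / (|R| + 1) : ℝ) : ℂ) • e) x = ((ε / (|R| + 1) : ℝ) : ℂ) * e x := rfl
    rw [h2, norm_mul, Complex.norm_real, Real.norm_of_nonneg (by positivity), div_mul_eq_mul_div,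
      div_le_iff₀ hR0]
    refine mul_le_mul_of_nonneg_left ?_ hε.le
    have h3 := (le_abs_self _).trans (hR x hx)
    linarith [he x, le_abs_self R])
  rw [map_smul, mem_closedBall_zero_iff, norm_smul, Complex.norm_real,
    Real.norm_of_nonneg (by positivity), div_mul_eq_mul_div, div_le_iff₀ hR0, one_mul] at h1
  rw [le_div_iff₀ hε, mul_comm]
  exact h1

end Represent

section Surjective

variable {W : WeightSequence} {d : ℕ} {E : Type*} [AddCommGroup E] [Module ℂ E]
  [TopologicalSpace E] [IsTopologicalAddGroup E] [ContinuousSMul ℂ E] [LocallyConvexSpace ℝ E]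
  [T2Space E]

/-- Smoothness from scalar functions: if the functionals map `y w` to the derivatives of smooth
functions, with bounds which are uniform on equicontinuous sets, then the `y w` are the derivatives
of a smooth function. -/
theorem isSmooth_of_scalar_family (y : List (Fin d) → Rd d → E) (g : DualC E → Rd d → ℂ)
    (hg : ∀ e, IsSmooth (g e)) (hy : ∀ w x (e : DualC E), e (y w x) = iterPartial w (g e) x)
    (hb : ∀ w (q : ContSeminorm E), ∃ C, ∀ e : DualC E, (∀ z, ‖e z‖ ≤ q.1 z) →
      ∀ x, ‖iterPartial w (g e) x‖ ≤ C) :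
    IsSmooth (y []) := by
  have := polynormableSpace_of_real (G := E)
  have hws := PolynormableSpace.withSeminorms ℂ E
  have hd : ∀ w i x, HasPartialDerivAt i (y w) (y (i :: w) x) x := by
    intro w i x
    rw [HasPartialDerivAt, hws.tendsto_nhds]
    intro q ε hε
    obtain ⟨C, hC⟩ := hb (i :: i :: w) q
    have hsmall : ∀ᶠ h : ℝ in 𝓝[≠] 0, C * |h| < ε := by
      have : Continuous fun h : ℝ => C * |h| := by fun_prop
      exact nhdsWithin_le_nhds (this.continuousAt.eventually_lt continuousAt_const (by simpa))
    filter_upwards [hsmall, self_mem_nhdsWithin] with h hh h0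
    refine lt_of_le_of_lt (seminorm_le_of_dual q _ fun e he => ?_) hh
    rw [map_sub, ← Complex.coe_smul, map_smul, map_sub, Complex.coe_smul]
    have e1 := hy w (x + h • EuclideanSpace.single i (1 : ℝ)) e
    have e2 := hy w x e
    have e3 := hy (i :: w) x e
    rw [e1, e2, e3]
    exact norm_slope_sub_le_of_partial_bound (fun x => (hg e).hasPartialDerivAt w i x)
      (fun x => (hg e).hasPartialDerivAt (i :: w) i x) (hC e he) x h h0
  have hc : ∀ w, Continuous (y w) := by
    intro w
    refine continuous_iff_continuousAt.2 fun x => ?_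
    rw [ContinuousAt, hws.tendsto_nhds]
    intro q ε hε
    choose C hC using fun i => hb (i :: w) q
    have hlip : ∀ i x (h : ℝ), q.1 (y w (x + h • EuclideanSpace.single i (1 : ℝ)) - y w x) ≤
        (∑ i, |C i|) * |h| := by
      intro i x h
      refine seminorm_le_of_dual q _ fun e he => ?_
      have e1 := hy w (x + h • EuclideanSpace.single i (1 : ℝ)) e
      have e2 := hy w x e
      rw [map_sub]
      rw [e1, e2]
      refine (norm_sub_le_of_partial_bound (fun x => (hg e).hasPartialDerivAt w i x)
        (fun x => hC i e he x) x h).trans (mul_le_mul_of_nonneg_right ?_ (abs_nonneg h))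
      exact (le_abs_self _).trans
        (Finset.single_le_sum (f := fun i => |C i|) (fun _ _ => abs_nonneg _) (Finset.mem_univ i))
    have hsmall : ∀ᶠ z in 𝓝 x, (∑ i, |C i|) * ∑ i, |(z - x) i| < ε := by
      have : Continuous fun z : Rd d => (∑ i, |C i|) * ∑ i, |(z - x) i| := by fun_prop
      exact this.continuousAt.eventually_lt continuousAt_const (by simpa)
    filter_upwards [hsmall] with z hz
    refine lt_of_le_of_lt ?_ hz
    have := seminorm_sub_le_of_coordinate_bound q.1 hlip x (z - x)
    rwa [add_sub_cancel] at this
  exact isSmooth_of_family y rfl hc hd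

/-- Every hypocontinuous functional `b` arises from a vector-valued function: the points `φ(x)`
represent the functionals `b(δ_x, ·)`, and the functions `e ∘ φ` represent the functionals
`b(·, e)`. -/
theorem exists_BdotVec_of_isHypocontinuous
    {b : DualC (Bdot W d) →ₗ[ℂ] DualC E →ₗ[ℂ] ℂ} (hb : IsHypocontinuous b) :
    ∃ φ : BdotVec W d E, ∀ u e, b u e = u (compBdot φ e) := by
  choose Φ hΦ using hb.exists_right_eval
  choose f hf using hb.exists_left_eval
  -- the functions `f e` are bounded, uniformly for `e` in an equicontinuous set
  have hbound : ∀ (q : ContSeminorm E) (t : RSeq), ∃ C : ℝ, ∀ e : DualC E,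
      (∀ z, ‖e z‖ ≤ q.1 z) → bdotSeminorm W d t (f e) ≤ C := by
    intro q t
    obtain ⟨C, hC⟩ := hb.exists_bound ⟨bdotSeminorm W d t, continuous_bdotSeminorm t⟩ q
    refine ⟨C, fun e he => ?_⟩
    refine seminorm_le_of_dual ⟨bdotSeminorm W d t, continuous_bdotSeminorm t⟩ (f e)
      fun u hu => ?_
    exact (congrArg norm (hf e u)).ge.trans (hC u hu e he)
  set y : List (Fin d) → Rd d → E := fun w x => Φ (derivEval w x) with hydef
  have hy : ∀ w x (e : DualC E), e (y w x) = iterPartial w (f e).1.toFun x := fun w x e => by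
    rw [hydef, ← hΦ, hf, derivEval_apply]
  have hsmooth := isSmooth_of_scalar_family y (fun e => (f e).1.toFun)
    (fun e => (f e).1.isSmooth) hy fun w q => by
      let t : RSeq := Classical.arbitrary _
      obtain ⟨C, hC⟩ := hbound q t
      refine ⟨C * (t.T w.length * W.M w.length), fun e he x => ?_⟩
      exact (norm_iterPartial_le t (f e).1 w x).trans (mul_le_mul_of_nonneg_right (hC e he)
        (mul_pos (t.T_pos _) (W.pos _)).le)
  have hcomp : ∀ e : DualC E, (fun x => e (y [] x)) = (f e).1.toFun := fun e =>
    funext fun x => hy [] x e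
  have hmd : ∀ (e : DualC E) α x, e (mDeriv α (y []) x) = mDeriv α (f e).1.toFun x := by
    intro e α x
    rw [← hcomp]
    exact (hsmooth.mDeriv_clm_comp e α x).symm
  let φ₀ : DLinf W d E := ⟨y [], hsmooth, fun q t => by
    obtain ⟨C, hC⟩ := hbound q t
    refine ⟨C, fun α x => ?_⟩
    rw [div_le_iff₀ (weight_pos W t α)]
    refine seminorm_le_of_dual q _ fun e he => ?_
    refine (congrArg norm (hmd e α x)).le.trans ?_
    exact (norm_mDeriv_le_bdotSeminorm t (f e) α x).trans
      (mul_le_mul_of_nonneg_right (hC e he) (weight_pos W t α).le)⟩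
  have hφ₀ : φ₀ ∈ BdotVec W d E := by
    intro ε hε q t
    obtain ⟨V, hV, h⟩ := hb.right {e | ∀ z, ‖e z‖ ≤ q.1 z}
      (equicontSet_of_seminorm q fun _ h => h) _ (Metric.closedBall_mem_nhds (0 : ℂ) hε)
    obtain ⟨K, ⟨hK, -, -⟩, -, δ, hδ, hKV⟩ := DualC.exists_compact_of_mem_nhds hV
    obtain ⟨L, hL, hdecay⟩ := exists_compact_uniform_decay hK t hδ
    refine ⟨L, hL, fun α x hx => ?_⟩
    rw [← seminorm_weight_inv_smul]
    refine seminorm_le_of_dual q _ fun e he => ?_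
    -- the functional `f ↦ D^α f(x) / (T_α M_α)` is small on `K`
    set u : DualC (Bdot W d) :=
      ((weight W t α : ℂ)⁻¹ * Complex.I⁻¹ ^ len α) • derivEval (indexList α) x with hu
    have hue : ∀ g : Bdot W d, u g = (weight W t α : ℂ)⁻¹ * mDeriv α g.1.toFun x := by
      intro g
      exact mul_assoc (weight W t α : ℂ)⁻¹ _ _
    have hm : ∀ z : ℂ, ‖(weight W t α : ℂ)⁻¹ * z‖ = ‖z‖ / weight W t α := fun z => by
      rw [norm_mul, norm_inv, Complex.norm_real, Real.norm_of_nonneg (weight_pos W t α).le,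
        inv_mul_eq_div]
    have hmem := h e he u (hKV u fun g hg => by
      rw [hue, hm, div_le_iff₀ (weight_pos W t α)]
      exact hdecay g hg α x hx)
    rw [hf, hue, mem_closedBall_zero_iff, ← hmd] at hmem
    rw [map_smul]
    exact hmem
  refine ⟨⟨φ₀, hφ₀⟩, fun u e => ?_⟩
  rw [hf]
  exact congrArg u (Subtype.ext (Subtype.ext (hcomp e).symm))

end Surjective

section Isomorphism

variable {W : WeightSequence} {d : ℕ} {E : Type*} [AddCommGroup E] [Module ℂ E]
  [UniformSpace E] [IsUniformAddGroup E] [ContinuousSMul ℂ E] [LocallyConvexSpace ℝ E]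
  [T2Space E] [CompleteSpace E]

theorem toEps_bijective : Function.Bijective (toEps (W := W) (d := d) (E := E)) := by
  constructor
  · intro φ ψ h
    refine Subtype.ext (Subtype.ext (funext fun x => eq_of_dual_eq fun e => ?_))
    exact (congrArg (fun b : Eps (Bdot W d) E => b.1 (derivEval [] x) e) h :)
  · intro b
    obtain ⟨φ, hφ⟩ := exists_BdotVec_of_isHypocontinuous b.2
    exact ⟨φ, Subtype.ext (LinearMap.ext₂ fun u e => (hφ u e).symm)⟩

theorem tendsto_eps_iff {F G ι : Type*} [AddCommGroup F] [Module ℂ F] [TopologicalSpace F]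
    [AddCommGroup G] [Module ℂ G] [TopologicalSpace G] {l : Filter ι} {b : ι → Eps F G}
    {b₀ : Eps F G} : Tendsto b l (𝓝 b₀) ↔ ∀ A B, EquicontSet A → EquicontSet B → ∀ ε > 0,
      ∀ᶠ i in l, ∀ u ∈ A, ∀ e ∈ B, ‖(b i).1 u e - b₀.1 u e‖ < ε := by
  rw [nhds_induced, tendsto_comap_iff, UniformOnFun.tendsto_iff_tendstoUniformlyOn]
  simp only [Metric.tendstoUniformlyOn_iff]
  constructor
  · intro h A B hA hB ε hε
    filter_upwards [h _ ⟨A, B, hA, hB, rfl⟩ ε hε] with i hi u hu e he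
    have := hi (u, e) ⟨hu, he⟩
    rwa [dist_comm, dist_eq_norm] at this
  · rintro h _ ⟨A, B, hA, hB, rfl⟩ ε hε
    filter_upwards [h A B hA hB ε hε] with i hi p hp
    rw [dist_comm, dist_eq_norm]
    exact hi p.1 hp.1 p.2 hp.2

theorem withSeminorms_BdotVec :
    WithSeminorms fun i => (qt W d E i).comp (BdotVec W d E).subtype :=
  IsInducing.subtypeVal.withSeminorms (withSeminorms_qt W d E)

theorem toEps_sub_apply (φ ψ : BdotVec W d E) (u : DualC (Bdot W d)) (e : DualC E) :
    (toEps φ).1 u e - (toEps ψ).1 u e = u (compBdot (φ - ψ) e) := by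
  have : (toEps (φ - ψ)).1 u e = (toEps φ).1 u e - (toEps ψ).1 u e := by
    rw [map_sub]
    rfl
  rw [← this, toEps_apply]

theorem continuous_toEps : Continuous (toEps (W := W) (d := d) (E := E)) := by
  refine continuous_iff_continuousAt.2 fun φ₀ => tendsto_eps_iff.2 fun A B hA hB ε hε => ?_
  obtain ⟨p, hp⟩ := hA.exists_seminorm
  obtain ⟨q, hq⟩ := hB.exists_seminorm
  obtain ⟨t, C, hC, hpC⟩ := exists_le_bdotSeminorm p
  have hδ : 0 < ε / (C + 1) := by positivity
  have h1 : Tendsto (fun φ : BdotVec W d E => φ) (𝓝 φ₀) (𝓝 φ₀) := tendsto_id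
  filter_upwards [(withSeminorms_BdotVec.tendsto_nhds _ φ₀).1 h1 (q, t) _ hδ] with φ hφ u hu e he
  rw [toEps_sub_apply]
  have h2 : bdotSeminorm W d t (compBdot (φ - φ₀) e) ≤ ε / (C + 1) :=
    bdotSeminorm_compBdot_le _ e t fun α x => (hq e he _).trans
      ((le_qt q t (φ - φ₀).1 α x).trans
        (mul_le_mul_of_nonneg_right (le_of_lt hφ) (weight_pos W t α).le))
  refine ((hp u hu _).trans ((hpC _).trans (mul_le_mul_of_nonneg_left h2 hC))).trans_lt ?_
  rw [mul_div_assoc', div_lt_iff₀ (by positivity)]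
  linarith

/-- Convergence of the functionals `toEps (φ i)` on the product of the polars of the seminorms
`‖·‖_{(t_j)}` and `q` is convergence of `φ i` with respect to `q_{(t_j)}`. -/
theorem tendsto_of_tendsto_toEps {ι : Type*} {l : Filter ι} {φ : ι → BdotVec W d E}
    {φ₀ : BdotVec W d E} (h : Tendsto (fun i => toEps (φ i)) l (𝓝 (toEps φ₀))) :
    Tendsto φ l (𝓝 φ₀) := by
  rw [withSeminorms_BdotVec.tendsto_nhds]
  rintro ⟨q, t⟩ ε hε
  let p : ContSeminorm (Bdot W d) := ⟨bdotSeminorm W d t, continuous_bdotSeminorm t⟩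
  filter_upwards [tendsto_eps_iff.1 h {u | ∀ z, ‖u z‖ ≤ p.1 z} {e | ∀ z, ‖e z‖ ≤ q.1 z}
    (equicontSet_of_seminorm p fun _ h => h) (equicontSet_of_seminorm q fun _ h => h) (ε / 2)
    (half_pos hε)] with i hi
  refine lt_of_le_of_lt (qt_le q t (C := ε / 2) fun α x => ?_) (half_lt_self hε)
  refine seminorm_le_of_dual q _ fun e he => ?_
  have h1 : bdotSeminorm W d t (compBdot (φ i - φ₀) e) ≤ ε / 2 :=
    seminorm_le_of_dual p _ fun u hu => by
      have := (hi u hu e he).le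
      rwa [toEps_sub_apply] at this
  have h2 := norm_mDeriv_le_bdotSeminorm t (compBdot (φ i - φ₀) e) α x
  have h3 : mDeriv α (compBdot (φ i - φ₀) e).1.toFun x = e (mDeriv α (φ i - φ₀).1.toFun x) :=
    mDeriv_compDLinf _ e α x
  rw [h3] at h2
  exact h2.trans (mul_le_mul_of_nonneg_right h1 (weight_pos W t α).le)

/-- The isomorphism with the `ε` tensor product. -/
def equivEps : BdotVec W d E ≃L[ℂ] Eps (Bdot W d) E where
  toLinearEquiv := LinearEquiv.ofBijective toEps toEps_bijective
  continuous_toFun := continuous_toEps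
  continuous_invFun := by
    refine continuous_iff_continuousAt.2 fun b => tendsto_of_tendsto_toEps ?_
    have h : ∀ b, toEps ((LinearEquiv.ofBijective toEps
        (toEps_bijective (W := W) (d := d) (E := E))).symm b) = b :=
      (LinearEquiv.ofBijective toEps toEps_bijective).apply_symm_apply
    change Tendsto (fun c => toEps ((LinearEquiv.ofBijective toEps toEps_bijective).symm c)) (𝓝 b)
      (𝓝 (toEps ((LinearEquiv.ofBijective toEps toEps_bijective).symm b)))
    simp only [h]
    exact tendsto_id

end Isomorphism

end Roumieu
end

theorem proposition130 (W : Roumieu.WeightSequence) (d : ℕ) (E : Type*) [AddCommGroup E]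
    [Module ℂ E] [UniformSpace E] [IsUniformAddGroup E] [ContinuousSMul ℂ E]
    [LocallyConvexSpace ℝ E] [T2Space E] [CompleteSpace E] :
    Nonempty (Roumieu.BdotVec W d E ≃L[ℂ] Roumieu.Eps (Roumieu.Bdot W d) E) :=
  ⟨Roumieu.equivEps⟩
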